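/- Let $M$ be a smooth Riemannian manifold with metric $\langle\cdot,\cdot\rangle$, Levi-Civita connection $\overline\nabla$ and curvature tensor $\overline R(X,Y)Z=\overline\nabla_X\overline\nabla_YZ-\overline\nabla_Y\overline\nabla_XZ-\overline\nabla_{[X,Y]}Z$. Let $\iota:L\to M$ be an immersed hypersurface (codimension one, with the induced metric) with a smooth unit normal field $N$. Let $A(X)=-(\overline\nabla_XN)^\top$ be its shape operator and $n=\dim L$. Let $S_k$ be the $k$-th elementary symmetric function of the eigenvalues $\kappa_1,\dots,\kappa_n$ of $A$ (so $S_0=1$ and $S_k=0$ for $k>n$), and define the Newton transformations by $T_0=I$, $T_k=S_kI-AT_{k-1}$. For $f\in C^\infty(L)$ let $$J_rf=\operatorname{Tr}(T_r\circ\operatorname{Hess}f)+\operatorname{Tr}(A^2T_r)\,f+\operatorname{Tr}(\overline R(N)T_r)\,f,\qquad \overline R(N)(X)=\overline R(X,N)N,$$ where $\operatorname{Hess}f(X)=\nabla_X\nabla f$ with the induced connection $\nabla$ of $L$, and for a normal field $fN$ let $J_r(fN)=J_r(f)N$. A smooth normal field $V$ along $L$ is called an $r$-th Jacobi field of $L$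 if $J_r(V)=0$. Let $r\ge 0$. If $S_{r+1}$ is constant on $L$, then for every Killing vector field $U$ on $M$ (a smooth vector field along which the Lie derivative of the metric vanishes) the normal component $U^\perp=\langle U,N\rangle N$ of $U$ along $L$ is an $r$-th Jacobi field of $L$, that is, $J_r(U^\perp)=0$ on $L$. -/

import Mathlib

set_option maxSynthPendingDepth 3

open scoped Manifold ContDiff Bundle

noncomputable section

namespace HypersurfaceJacobi

open Bundle

/-! ### Metrics on open subsets of a vector space

`g` is a field of bilinear forms on the vector space `E`. -/

section Coordinates

variable {E : Type*} [NormedAddCommGroup E] [NormedSpace ℝ E]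

/-- The Christoffel symbols of the first kind of `g` at `y`:
`(a, b, c) ↦ (∂_a g(b, c) + ∂_b g(a, c) - ∂_c g(a, b)) / 2`. -/
def christoffelFirst (g : E → E →L[ℝ] E →L[ℝ] ℝ) (y : E) : E →L[ℝ] E →L[ℝ] E →L[ℝ] ℝ :=
  let D : E →L[ℝ] E →L[ℝ] E →L[ℝ] ℝ := fderiv ℝ g y
  let D' : E →L[ℝ] E →L[ℝ] E →L[ℝ] ℝ :=
    (ContinuousLinearMap.flipₗᵢ ℝ E E ℝ).toContinuousLinearEquiv.toContinuousLinearMap ∘L D.flip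
  (1 / 2 : ℝ) • (D + D.flip - D')

/-- The Christoffel symbols (of the second kind) `Γ_y(a, b)` of `g` at `y`, where `g_y` is
nondegenerate: the vector `Γ_y(a, b)` satisfies
`g_y(Γ_y(a, b), c) = (∂_a g(b, c) + ∂_b g(a, c) - ∂_c g(a, b)) / 2` for all `c`. -/
def christoffel (g : E → E →L[ℝ] E →L[ℝ] ℝ) (y : E) : E →L[ℝ] E →L[ℝ] E :=
  ContinuousLinearMap.compL ℝ E (E →L[ℝ] ℝ) E (g y).inverse ∘L christoffelFirst g y

/-- The curvature tensor `R(a, b)c` of `g` at `y`, with the convention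
`R(X, Y)Z = ∇_X ∇_Y Z - ∇_Y ∇_X Z - ∇_{[X, Y]} Z`. -/
def curvature (g : E → E →L[ℝ] E →L[ℝ] ℝ) (y a b c : E) : E :=
  let Γ : E →L[ℝ] E →L[ℝ] E := christoffel g y
  let DΓ : E →L[ℝ] E →L[ℝ] E →L[ℝ] E := fderiv ℝ (christoffel g) y
  DΓ a b c - DΓ b a c + Γ a (Γ b c) - Γ b (Γ a c)

/-- The linear operator `a ↦ R(a, b)b` at `y`. -/
def jacobiCurvature (g : E → E →L[ℝ] E →L[ℝ] ℝ) (y b : E) : E →ₗ[ℝ] E where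
  toFun a := curvature g y a b b
  map_add' a a' := by
    simp only [curvature, map_add, add_apply]
    abel
  map_smul' t a := by
    simp only [curvature, map_smul, smul_apply, RingHom.id_apply, smul_add, smul_sub]

end Coordinates

/-! ### Riemannian manifolds

A manifold here is modelled on a finite-dimensional real vector space `E` (no boundary). Its tangent
space at `x` is `E`, read in the preferred chart at `x`. -/

section Ambient

variable {E : Type*} [NormedAddCommGroup E] [NormedSpace ℝ E]
  {M : Type*} [TopologicalSpace M] [ChartedSpace E M] [IsManifold 𝓘(ℝ, E) ∞ M]
  [RiemannianBundle (fun x : M ↦ TangentSpace 𝓘(ℝ, E) x)]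

/-- The metric in the preferred chart at `x`: the bilinear form `(a, b) ↦ g_y(a, b)`
at the coordinate point `y`. -/
def metricInChart (x : M) (y : E) : E →L[ℝ] E →L[ℝ] ℝ :=
  let z : M := (extChartAt 𝓘(ℝ, E) x).symm y
  let S : E →L[ℝ] TangentSpace 𝓘(ℝ, E) z :=
    (trivializationAt E (TangentSpace 𝓘(ℝ, E) : M → Type _) x).symmL ℝ z
  (innerSL ℝ : TangentSpace 𝓘(ℝ, E) z →L[ℝ] TangentSpace 𝓘(ℝ, E) z →L[ℝ] ℝ).bilinearComp S S

/-- A Killing vector field: a smooth vector field `U` such that the Lie derivative of the metric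
along `U` vanishes, `U⟨X, Y⟩ = ⟨[U, X], Y⟩ + ⟨X, [U, Y]⟩`. -/
structure IsKillingField (U : ∀ x : M, TangentSpace 𝓘(ℝ, E) x) : Prop where
  contMDiff : ContMDiff 𝓘(ℝ, E) 𝓘(ℝ, E).tangent ∞
    (fun x ↦ (⟨x, U x⟩ : TangentBundle 𝓘(ℝ, E) M))
  lieDerivative_metric : ∀ (x : M) (X Y : ∀ x : M, TangentSpace 𝓘(ℝ, E) x),
    MDifferentiableAt 𝓘(ℝ, E) 𝓘(ℝ, E).tangent
      (fun y ↦ (⟨y, X y⟩ : TangentBundle 𝓘(ℝ, E) M)) x →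
    MDifferentiableAt 𝓘(ℝ, E) 𝓘(ℝ, E).tangent
      (fun y ↦ (⟨y, Y y⟩ : TangentBundle 𝓘(ℝ, E) M)) x →
    mvfderiv 𝓘(ℝ, E) (fun y ↦ inner ℝ (X y) (Y y)) x (U x) =
      inner ℝ (VectorField.mlieBracket 𝓘(ℝ, E) U X x) (Y x)
        + inner ℝ (X x) (VectorField.mlieBracket 𝓘(ℝ, E) U Y x)

end Ambient

/-! ### Hypersurfaces

`ι : L → M` is an immersed submanifold with its induced metric, and `N` is a vector field
along `ι`. -/

section Hypersurface

variable {E : Type*} [NormedAddCommGroup E] [NormedSpace ℝ E] [FiniteDimensional ℝ E]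
  {M : Type*} [TopologicalSpace M] [ChartedSpace E M] [IsManifold 𝓘(ℝ, E) ∞ M]
  [RiemannianBundle (fun x : M ↦ TangentSpace 𝓘(ℝ, E) x)]
  {F : Type*} [NormedAddCommGroup F] [NormedSpace ℝ F] [FiniteDimensional ℝ F]
  {L : Type*} [TopologicalSpace L] [ChartedSpace F L] [IsManifold 𝓘(ℝ, F) ∞ L]
  [RiemannianBundle (fun p : L ↦ TangentSpace 𝓘(ℝ, F) p)]

instance finiteDimensionalTangentSpace (x : M) : FiniteDimensional ℝ (TangentSpace 𝓘(ℝ, E) x) :=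
  inferInstanceAs (FiniteDimensional ℝ E)

instance completeSpaceTangentSpace (x : M) : CompleteSpace (TangentSpace 𝓘(ℝ, E) x) :=
  FiniteDimensional.complete ℝ _

/-- `ι : L → M` is a smooth immersion and the metric of `L` is the one induced by `ι`. -/
structure IsIsometricImmersion (ι : L → M) : Prop where
  contMDiff : ContMDiff 𝓘(ℝ, F) 𝓘(ℝ, E) ∞ ι
  inner_mfderiv : ∀ (p : L) (v w : TangentSpace 𝓘(ℝ, F) p),
    inner ℝ (mfderiv 𝓘(ℝ, F) 𝓘(ℝ, E) ι p v) (mfderiv 𝓘(ℝ, F) 𝓘(ℝ, E) ι p w) = inner ℝ v w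

/-- `N` is a smooth unit normal field along `ι`. -/
structure IsUnitNormal (ι : L → M) (N : ∀ p : L, TangentSpace 𝓘(ℝ, E) (ι p)) : Prop where
  contMDiff : ContMDiff 𝓘(ℝ, F) 𝓘(ℝ, E).tangent ∞
    (fun p ↦ (⟨ι p, N p⟩ : TangentBundle 𝓘(ℝ, E) M))
  norm_eq_one : ∀ p, ‖N p‖ = 1
  inner_eq_zero : ∀ (p : L) (v : TangentSpace 𝓘(ℝ, F) p),
    inner ℝ (mfderiv 𝓘(ℝ, F) 𝓘(ℝ, E) ι p v) (N p) = 0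

/-- The Levi-Civita covariant derivative `v ↦ ∇̄_v V` of a vector field `V` along `ι`: in the
preferred chart at `ι p` it is `v ↦ dV(v) + Γ(dι v, V)`. -/
def covDerivAlong (ι : L → M) (V : ∀ p : L, TangentSpace 𝓘(ℝ, E) (ι p)) (p : L) :
    TangentSpace 𝓘(ℝ, F) p →L[ℝ] TangentSpace 𝓘(ℝ, E) (ι p) :=
  let Vc : L → E := fun q ↦
    (trivializationAt E (TangentSpace 𝓘(ℝ, E) : M → Type _) (ι p) ⟨ι q, V q⟩).2
  let dVc : F →L[ℝ] E := mvfderiv 𝓘(ℝ, F) Vc p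
  let dι : F →L[ℝ] E := mfderiv 𝓘(ℝ, F) 𝓘(ℝ, E) ι p
  let Γ : E →L[ℝ] E →L[ℝ] E :=
    christoffel (metricInChart (ι p)) (extChartAt 𝓘(ℝ, E) (ι p) (ι p))
  let D : F →L[ℝ] E := dVc + Γ.flip (V p) ∘L dι
  D

/-- The tangential component at `p`, as a vector `w^⊤` of `T_pL`: it is determined by
`⟨w^⊤, v⟩ = ⟨w, dι v⟩` for all `v` in `T_pL`. For an isometric immersion, `dι (w^⊤)` is the
orthogonal projection of `w` to the image of `dι`. -/
def tangentialPart (ι : L → M) (p : L) :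
    TangentSpace 𝓘(ℝ, E) (ι p) →L[ℝ] TangentSpace 𝓘(ℝ, F) p :=
  ContinuousLinearMap.adjoint (mfderiv 𝓘(ℝ, F) 𝓘(ℝ, E) ι p)

/-- The normal component `U^⊥` along `ι` of a vector field `U` on `M`: the orthogonal projection to
the orthogonal complement of the tangent space of `L`. -/
def normalPart (ι : L → M) (U : ∀ x : M, TangentSpace 𝓘(ℝ, E) x) (p : L) :
    TangentSpace 𝓘(ℝ, E) (ι p) :=
  (mfderiv 𝓘(ℝ, F) 𝓘(ℝ, E) ι p).rangeᗮ.starProjection (U (ι p))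

/-- The shape operator `A(v) = -(∇̄_v N)^⊤`. -/
def shapeOperator (ι : L → M) (N : ∀ p : L, TangentSpace 𝓘(ℝ, E) (ι p)) (p : L) :
    TangentSpace 𝓘(ℝ, F) p →ₗ[ℝ] TangentSpace 𝓘(ℝ, F) p :=
  -(tangentialPart (E := E) (F := F) ι p ∘L covDerivAlong ι N p).toLinearMap

/-- `S_r`: the `r`-th elementary symmetric function of the principal curvatures, which are the
eigenvalues of the shape operator, with multiplicity. -/
def meanCurv (ι : L → M) (N : ∀ p : L, TangentSpace 𝓘(ℝ, E) (ι p)) (r : ℕ) (p : L) : ℝ :=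
  (shapeOperator (F := F) ι N p).charpoly.roots.esymm r

/-- The Newton transformations `T_0 = I`, `T_{r+1} = S_{r+1} I - A T_r`. -/
def newton (ι : L → M) (N : ∀ p : L, TangentSpace 𝓘(ℝ, E) (ι p)) :
    ℕ → ∀ p : L, TangentSpace 𝓘(ℝ, F) p →ₗ[ℝ] TangentSpace 𝓘(ℝ, F) p
  | 0, _ => LinearMap.id
  | r + 1, p => meanCurv (F := F) ι N (r + 1) p • LinearMap.id - shapeOperator ι N p ∘ₗ newton ι N r p

/-- The gradient of a function on `L`. -/
def grad (f : L → ℝ) (p : L) : TangentSpace 𝓘(ℝ, F) p :=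
  (InnerProductSpace.toDual ℝ (TangentSpace 𝓘(ℝ, F) p)).symm (mvfderiv 𝓘(ℝ, F) f p)

/-- The Hessian operator `v ↦ ∇_v (grad f)`, where `∇_X Y = (∇̄_X Y)^⊤` is the connection of `L`
induced by the ambient one. -/
def hess (ι : L → M) (f : L → ℝ) (p : L) :
    TangentSpace 𝓘(ℝ, F) p →ₗ[ℝ] TangentSpace 𝓘(ℝ, F) p :=
  (tangentialPart (E := E) (F := F) ι p ∘L
    covDerivAlong ι (fun q ↦ mfderiv 𝓘(ℝ, F) 𝓘(ℝ, E) ι q (grad f q)) p).toLinearMap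

/-- The operator `R̄(N)(v) = R̄(v, N)N` on the tangent space of `L`. -/
def normalCurvature (ι : L → M) (N : ∀ p : L, TangentSpace 𝓘(ℝ, E) (ι p)) (p : L) :
    TangentSpace 𝓘(ℝ, F) p →ₗ[ℝ] TangentSpace 𝓘(ℝ, F) p :=
  let R : TangentSpace 𝓘(ℝ, E) (ι p) →ₗ[ℝ] TangentSpace 𝓘(ℝ, E) (ι p) :=
    jacobiCurvature (E := E) (metricInChart (ι p)) (extChartAt 𝓘(ℝ, E) (ι p) (ι p)) (N p)
  (tangentialPart (E := E) (F := F) ι p).toLinearMap ∘ₗ R ∘ₗ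
    (mfderiv 𝓘(ℝ, F) 𝓘(ℝ, E) ι p).toLinearMap

/-- `L_r f = Tr (T_r ∘ Hess f)`. -/
def opL (ι : L → M) (N : ∀ p : L, TangentSpace 𝓘(ℝ, E) (ι p)) (r : ℕ) (f : L → ℝ) (p : L) : ℝ :=
  LinearMap.trace ℝ _ (newton (F := F) ι N r p ∘ₗ hess (E := E) ι f p)

/-- `J_r f = L_r f + Tr (A² T_r) f + Tr (R̄(N) T_r) f`. -/
def opJ (ι : L → M) (N : ∀ p : L, TangentSpace 𝓘(ℝ, E) (ι p)) (r : ℕ) (f : L → ℝ) (p : L) : ℝ :=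
  opL (F := F) ι N r f p
    + LinearMap.trace ℝ _ (shapeOperator (F := F) ι N p ∘ₗ shapeOperator ι N p ∘ₗ newton ι N r p) * f p
    + LinearMap.trace ℝ _ (normalCurvature (F := F) ι N p ∘ₗ newton ι N r p) * f p

/-- `J_r` on normal fields, `J_r (f N) = J_r(f) N`; a normal field `V` is `f N` with
`f = ⟨V, N⟩`. -/
def opJNormal (ι : L → M) (N : ∀ p : L, TangentSpace 𝓘(ℝ, E) (ι p)) (r : ℕ)
    (V : ∀ p : L, TangentSpace 𝓘(ℝ, E) (ι p)) (p : L) : TangentSpace 𝓘(ℝ, E) (ι p) :=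
  opJ (F := F) ι N r (fun q ↦ inner ℝ (V q) (N q)) p • N p

/-- An `r`-th Jacobi field: a smooth normal field `V` along `L` with `J_r V = 0`. -/
structure IsJacobiField (ι : L → M) (N : ∀ p : L, TangentSpace 𝓘(ℝ, E) (ι p)) (r : ℕ)
    (V : ∀ p : L, TangentSpace 𝓘(ℝ, E) (ι p)) : Prop where
  contMDiff : ContMDiff 𝓘(ℝ, F) 𝓘(ℝ, E).tangent ∞
    (fun p ↦ (⟨ι p, V p⟩ : TangentBundle 𝓘(ℝ, E) M))
  inner_eq_zero : ∀ (p : L) (v : TangentSpace 𝓘(ℝ, F) p),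
    inner ℝ (mfderiv 𝓘(ℝ, F) 𝓘(ℝ, E) ι p v) (V p) = 0
  opJNormal_eq_zero : ∀ p, opJNormal (F := F) ι N r V p = 0

end Hypersurface

end HypersurfaceJacobi

end

/-! Write `f = ⟨U, N⟩`, let `X` be the tangential part of `U`, and let `B` be the tangential part of
`v ↦ ∇̄_v U`. The proof rests on one operator identity on the hypersurface: `Hess f = (BA - AB) -
∇_X A - f A² - f R̄(N)`. It comes from differentiating `df(b) = ⟨∇̄_b U, N⟩ - ⟨U, A b⟩` once more.
The second derivatives of a Killing field are curvature, because its flow preserves the Levi-Civita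
connection. Skewness of the curvature moves it onto `N`. Splitting `U = X + f N` then gives the
Codazzi equation on `X` and the term `f R̄(N)` on `f N`. Skewness of `∇̄U` produces the commutator
and disposes of the component of `∇̄U` along `N`.

Now multiply by `T_r` and take the trace. The commutator contributes nothing, since `T_r` commutes
with `A`. The term in `∇_X A` contributes `Tr(T_r ∇_X A) = X(S_{r+1})`, which vanishes because
`S_{r+1}` is constant. What remains is `J_r f = 0`.

The identity is `IsMetricOn.hessian_support_function`, proved in coordinates on vector spaces, with
the plain derivative of `A` in place of `∇_X A`: the two differ by a commutator with `A`, which the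
trace does not see. The formula `dS_{r+1} = Tr(T_r dA)` is `trace_newtonTransform_comp_eq_zero`.
Since `S_k` is defined from the real roots of the characteristic polynomial, it needs that
polynomial to split, which holds because `A` is self-adjoint. The rest identifies each invariant
object with its expression in the charts fixed at one point `p`. The delicate case is the covariant
derivative, defined at `q` through the chart at `ι q`; there the transformation law of the
Christoffel symbols is needed. -/

noncomputable section

namespace HypersurfaceJacobi

open Bundle

/-! ### Christoffel symbols and curvature of a metric in coordinates -/

section LocalMetric

variable {E : Type*} [NormedAddCommGroup E] [NormedSpace ℝ E]
  {F : Type*} [NormedAddCommGroup F] [NormedSpace ℝ F]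

/-- A smooth Riemannian metric on an open subset of a vector space. -/
structure IsMetricOn (g : E → E →L[ℝ] E →L[ℝ] ℝ) (O : Set E) : Prop where
  isOpen : IsOpen O
  contDiffOn : ContDiffOn ℝ ∞ g O
  symm : ∀ y ∈ O, ∀ a b, g y a b = g y b a
  pos : ∀ y ∈ O, ∀ a, a ≠ 0 → 0 < g y a a

/-- Positivity gives injectivity, and `E` and its dual have the same dimension. Needed because
`ContinuousLinearMap.inverse` is zero on non-invertible maps. -/
theorem isInvertible_of_pos [FiniteDimensional ℝ E] {b : E →L[ℝ] E →L[ℝ] ℝ}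
    (hb : ∀ a, a ≠ 0 → 0 < b a a) : b.IsInvertible := by
  have hinj : Function.Injective b := by
    rw [injective_iff_map_eq_zero]
    intro a ha
    by_contra h
    have := hb a h
    simp [ha] at this
  have hfr : Module.finrank ℝ E = Module.finrank ℝ (E →L[ℝ] ℝ) := by
    rw [← (LinearMap.toContinuousLinearMap (𝕜 := ℝ) (E := E) (F' := ℝ)).finrank_eq]
    exact (Subspace.dual_finrank_eq (K := ℝ) (V := E)).symm
  exact ⟨(LinearEquiv.ofInjectiveOfFinrankEq b.toLinearMap hinj hfr).toContinuousLinearEquiv,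
    by ext; rfl⟩

theorem apply_inverse_of_isInvertible {b : E →L[ℝ] F} (hb : b.IsInvertible) (y : F) :
    b (b.inverse y) = y := by
  obtain ⟨e, rfl⟩ := hb
  simp

theorem contDiffOn_inverse [CompleteSpace E] {f : F → E →L[ℝ] E →L[ℝ] ℝ} {s : Set F}
    (hf : ContDiffOn ℝ ∞ f s) (hi : ∀ y ∈ s, (f y).IsInvertible) :
    ContDiffOn ℝ ∞ (fun y ↦ (f y).inverse) s := by
  intro y hy
  obtain ⟨e, he⟩ := hi y hy
  exact ContDiffAt.comp_contDiffWithinAt y (he ▸ contDiffAt_map_inverse e) (hf y hy)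

/-- The device by which an identity valid near a point is differentiated; metric compatibility, the
Killing equation and orthogonality to `N` are all differentiated this way. -/
theorem hasFDerivAt_apply_eq_of_eqOn {f k : E → F} {f' k' : E →L[ℝ] F} {y : E} {s : Set E}
    (hs : s ∈ nhds y) (hf : HasFDerivAt f f' y) (hk : HasFDerivAt k k' y)
    (h : ∀ z ∈ s, f z = k z) (e : E) : f' e = k' e := by
  have : f =ᶠ[nhds y] k := by filter_upwards [hs] with z hz using h z hz
  rw [hf.unique (hk.congr_of_eventuallyEq this)]

theorem fderiv_fderiv_symm {f : E → F} {y : E} (hf : ContDiffAt ℝ ∞ f y) (a b : E) :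
    fderiv ℝ (fderiv ℝ f) y a b = fderiv ℝ (fderiv ℝ f) y b a :=
  (hf.isSymmSndFDerivAt (by simpa using ENat.LEInfty.out)) a b

namespace IsMetricOn

variable {g : E → E →L[ℝ] E →L[ℝ] ℝ} {O : Set E} {y : E}

theorem contDiffAt (hg : IsMetricOn g O) (hy : y ∈ O) : ContDiffAt ℝ ∞ g y :=
  hg.contDiffOn.contDiffAt (hg.isOpen.mem_nhds hy)

theorem differentiableAt (hg : IsMetricOn g O) (hy : y ∈ O) : DifferentiableAt ℝ g y :=
  (hg.contDiffAt hy).differentiableAt (by simp)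

theorem ext_left (hg : IsMetricOn g O) (hy : y ∈ O) {v w : E} (h : ∀ c, g y v c = g y w c) :
    v = w := by
  by_contra hne
  have := hg.pos y hy (v - w) (sub_ne_zero.2 hne)
  simp [h] at this

theorem fderiv_symm (hg : IsMetricOn g O) (hy : y ∈ O) (a b c : E) :
    fderiv ℝ g y a b c = fderiv ℝ g y a c b := by
  have h : ∀ b c, fderiv ℝ g y a b c = fderiv ℝ (fun z ↦ g z b c) y a := by
    intro b c
    have := (((hg.differentiableAt hy).hasFDerivAt).clm_apply (hasFDerivAt_const b y)).clm_apply
      (hasFDerivAt_const c y)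
    rw [this.fderiv]; simp
  rw [h, h]
  congr 1
  refine Filter.EventuallyEq.fderiv_eq ?_
  filter_upwards [hg.isOpen.mem_nhds hy] with z hz using hg.symm z hz b c

theorem contDiffOn_fderiv (hg : IsMetricOn g O) : ContDiffOn ℝ ∞ (fderiv ℝ g) O :=
  hg.contDiffOn.fderiv_of_isOpen hg.isOpen (by simp)

theorem hasFDerivAt_fderiv (hg : IsMetricOn g O) (hy : y ∈ O) :
    HasFDerivAt (fderiv ℝ g) (fderiv ℝ (fderiv ℝ g) y) y :=
  ((hg.contDiffOn_fderiv.contDiffAt (hg.isOpen.mem_nhds hy)).differentiableAt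
    (by simp)).hasFDerivAt

variable [FiniteDimensional ℝ E]

theorem isInvertible (hg : IsMetricOn g O) (hy : y ∈ O) : (g y).IsInvertible :=
  isInvertible_of_pos (hg.pos y hy)

theorem apply_christoffel (hg : IsMetricOn g O) (hy : y ∈ O) (a b c : E) :
    g y (christoffel g y a b) c =
      (fderiv ℝ g y a b c + fderiv ℝ g y b a c - fderiv ℝ g y c a b) / 2 := by
  have : g y (christoffel g y a b) = christoffelFirst g y a b := by
    simp [christoffel, apply_inverse_of_isInvertible (hg.isInvertible hy)]
  rw [this]
  simp [christoffelFirst]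
  ring

theorem christoffel_symm (hg : IsMetricOn g O) (hy : y ∈ O) (a b : E) :
    christoffel g y a b = christoffel g y b a := by
  refine hg.ext_left hy fun c ↦ ?_
  rw [hg.apply_christoffel hy, hg.apply_christoffel hy, hg.fderiv_symm hy c a b]
  ring

/-- Metric compatibility, `∇g = 0`: in the sum of the two Christoffel formulas everything cancels
except the derivative along `a`. -/
theorem fderiv_eq (hg : IsMetricOn g O) (hy : y ∈ O) (a b c : E) :
    fderiv ℝ g y a b c = g y (christoffel g y a b) c + g y b (christoffel g y a c) := by
  rw [hg.symm y hy b, hg.apply_christoffel hy, hg.apply_christoffel hy, hg.fderiv_symm hy a b c,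
    hg.fderiv_symm hy b a c, hg.fderiv_symm hy c a b]
  ring

theorem contDiffOn_christoffel (hg : IsMetricOn g O) : ContDiffOn ℝ ∞ (christoffel g) O := by
  have h1 := contDiffOn_inverse hg.contDiffOn fun y hy ↦ hg.isInvertible hy
  have hD := hg.contDiffOn_fderiv
  unfold christoffel christoffelFirst
  have hflip : ContDiffOn ℝ ∞ (fun y ↦ (fderiv ℝ g y).flip) O :=
    (ContinuousLinearMap.flipₗᵢ ℝ E E (E →L[ℝ] ℝ)).contDiff.comp_contDiffOn hD
  have hD' : ContDiffOn ℝ ∞ (fun y ↦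
      (ContinuousLinearMap.flipₗᵢ ℝ E E ℝ).toContinuousLinearEquiv.toContinuousLinearMap ∘L
        (fderiv ℝ g y).flip) O := contDiffOn_const.clm_comp hflip
  exact ((ContinuousLinearMap.contDiff _).comp_contDiffOn h1).clm_comp
    (((hD.add hflip).sub hD').const_smul (1 / 2 : ℝ))

theorem differentiableAt_christoffel (hg : IsMetricOn g O) (hy : y ∈ O) :
    DifferentiableAt ℝ (christoffel g) y :=
  (hg.contDiffOn_christoffel.contDiffAt (hg.isOpen.mem_nhds hy)).differentiableAt (by simp)

theorem fderiv_christoffel_symm (hg : IsMetricOn g O) (hy : y ∈ O) (a b c : E) :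
    fderiv ℝ (christoffel g) y a b c = fderiv ℝ (christoffel g) y a c b := by
  have h : ∀ b c, fderiv ℝ (christoffel g) y a b c =
      fderiv ℝ (fun z ↦ christoffel g z b c) y a := by
    intro b c
    have := (((hg.differentiableAt_christoffel hy).hasFDerivAt).clm_apply
      (hasFDerivAt_const b y)).clm_apply (hasFDerivAt_const c y)
    rw [this.fderiv]; simp
  rw [h, h]
  congr 1
  refine Filter.EventuallyEq.fderiv_eq ?_
  filter_upwards [hg.isOpen.mem_nhds hy] with z hz using hg.christoffel_symm hz b c

theorem fderiv_fderiv_eq (hg : IsMetricOn g O) (hy : y ∈ O) (e a b c : E) :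
    fderiv ℝ (fderiv ℝ g) y e a b c =
      fderiv ℝ g y e (christoffel g y a b) c + g y (fderiv ℝ (christoffel g) y e a b) c
        + fderiv ℝ g y e b (christoffel g y a c) + g y b (fderiv ℝ (christoffel g) y e a c) := by
  have h1 := ((((hg.hasFDerivAt_fderiv hy).clm_apply (hasFDerivAt_const a y)).clm_apply
    (hasFDerivAt_const b y)).clm_apply (hasFDerivAt_const c y))
  have hΓ := (hg.differentiableAt_christoffel hy).hasFDerivAt
  have hg' := (hg.differentiableAt hy).hasFDerivAt
  have h2 := (hg'.clm_apply ((hΓ.clm_apply (hasFDerivAt_const a y)).clm_apply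
    (hasFDerivAt_const b y))).clm_apply (hasFDerivAt_const c y)
  have h3 := (hg'.clm_apply (hasFDerivAt_const b y)).clm_apply
    ((hΓ.clm_apply (hasFDerivAt_const a y)).clm_apply (hasFDerivAt_const c y))
  have := hasFDerivAt_apply_eq_of_eqOn (hg.isOpen.mem_nhds hy) h1 (h2.add h3)
    (fun z hz ↦ hg.fderiv_eq hz a b c) e
  simp at this
  linarith

/-- Differentiate `∇g = 0` and antisymmetrise in the two directions of differentiation: second
derivatives of `g` cancel by symmetry and only curvature terms are left. -/
theorem apply_curvature_skew (hg : IsMetricOn g O) (hy : y ∈ O) (a b c d : E) :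
    g y (curvature g y a b c) d = - g y c (curvature g y a b d) := by
  have h1 := hg.fderiv_fderiv_eq hy a b c d
  have h2 := hg.fderiv_fderiv_eq hy b a c d
  rw [fderiv_fderiv_symm (hg.contDiffAt hy) b a, h1] at h2
  simp only [hg.fderiv_eq hy] at h2
  simp [curvature]
  linarith

/-- The Christoffel symbols of a pulled back metric. -/
theorem apply_christoffel_pullback (hg : IsMetricOn g O) [FiniteDimensional ℝ F]
    {h : F → F →L[ℝ] F →L[ℝ] ℝ} {s : Set F}
    (hh : IsMetricOn h s) {φ : F → E} (hφ : ContDiffOn ℝ ∞ φ s) (hmaps : Set.MapsTo φ s O)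
    (hpull : ∀ u ∈ s, ∀ a b, h u a b = g (φ u) (fderiv ℝ φ u a) (fderiv ℝ φ u b))
    {u : F} (hu : u ∈ s) (a b c : F) :
    h u (christoffel h u a b) c = g (φ u)
      (fderiv ℝ (fderiv ℝ φ) u a b + christoffel g (φ u) (fderiv ℝ φ u a) (fderiv ℝ φ u b))
      (fderiv ℝ φ u c) := by
  have hs := hh.isOpen.mem_nhds hu
  have hφu := hφ.contDiffAt hs
  have hφ1 := (hφu.differentiableAt (by simp)).hasFDerivAt
  have hφ2 := (((hφ.fderiv_of_isOpen (m := ∞) hh.isOpen (by simp)).contDiffAt hs).differentiableAt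
    (by simp)).hasFDerivAt
  have hO := hmaps hu
  have key : ∀ a b c : F, fderiv ℝ h u a b c =
      fderiv ℝ g (φ u) (fderiv ℝ φ u a) (fderiv ℝ φ u b) (fderiv ℝ φ u c)
        + g (φ u) (fderiv ℝ (fderiv ℝ φ) u a b) (fderiv ℝ φ u c)
        + g (φ u) (fderiv ℝ φ u b) (fderiv ℝ (fderiv ℝ φ) u a c) := by
    intro a b c
    have h1 := ((hh.differentiableAt hu).hasFDerivAt.clm_apply (hasFDerivAt_const b u)).clm_apply
      (hasFDerivAt_const c u)
    have h2 := (((hg.differentiableAt hO).hasFDerivAt.comp u hφ1).clm_apply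
      (hφ2.clm_apply (hasFDerivAt_const b u))).clm_apply (hφ2.clm_apply (hasFDerivAt_const c u))
    have := hasFDerivAt_apply_eq_of_eqOn hs h1 h2 (fun z hz ↦ hpull z hz b c) a
    simp at this
    linarith
  rw [hh.apply_christoffel hu, map_add, add_apply, hg.apply_christoffel hO, key, key, key,
    fderiv_fderiv_symm hφu b a, fderiv_fderiv_symm hφu c a, fderiv_fderiv_symm hφu c b,
    hg.symm _ hO (fderiv ℝ φ u b) (fderiv ℝ (fderiv ℝ φ) u a c),
    hg.symm _ hO (fderiv ℝ φ u a) (fderiv ℝ (fderiv ℝ φ) u b c)]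
  ring

/-- The Christoffel symbols are invariant under the flow of a Killing field. -/
theorem lieDerivative_christoffel_eq_zero (hg : IsMetricOn g O) {U : E → E}
    (hU : ContDiffOn ℝ ∞ U O)
    (hK : ∀ y ∈ O, ∀ a b, fderiv ℝ g y (U y) a b + g y (fderiv ℝ U y a) b
      + g y a (fderiv ℝ U y b) = 0) (hy : y ∈ O) (a b : E) :
    fderiv ℝ (fderiv ℝ U) y a b + fderiv ℝ (christoffel g) y (U y) a b
      + christoffel g y (fderiv ℝ U y a) b + christoffel g y a (fderiv ℝ U y b)
      - fderiv ℝ U y (christoffel g y a b) = 0 := by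
  have hs := hg.isOpen.mem_nhds hy
  have hUy := hU.contDiffAt hs
  have hU1 := (hUy.differentiableAt (by simp)).hasFDerivAt
  have hU2 := (((hU.fderiv_of_isOpen (m := ∞) hg.isOpen (by simp)).contDiffAt hs).differentiableAt
    (by simp)).hasFDerivAt
  have hg1 := (hg.differentiableAt hy).hasFDerivAt
  have hg2 := hg.hasFDerivAt_fderiv hy
  have hΓ := (hg.differentiableAt_christoffel hy).hasFDerivAt
  -- The Killing equation differentiated along `c`.
  have key : ∀ c a b : E, fderiv ℝ (fderiv ℝ g) y c (U y) a b
      + fderiv ℝ g y (fderiv ℝ U y c) a b + fderiv ℝ g y c (fderiv ℝ U y a) b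
      + g y (fderiv ℝ (fderiv ℝ U) y c a) b + fderiv ℝ g y c a (fderiv ℝ U y b)
      + g y a (fderiv ℝ (fderiv ℝ U) y c b) = 0 := by
    intro c a b
    have ca := hasFDerivAt_const (𝕜 := ℝ) a y
    have cb := hasFDerivAt_const (𝕜 := ℝ) b y
    have h1 := (((hg2.clm_apply hU1).clm_apply ca).clm_apply cb).add
      ((hg1.clm_apply (hU2.clm_apply ca)).clm_apply cb) |>.add
      ((hg1.clm_apply ca).clm_apply (hU2.clm_apply cb))
    have := hasFDerivAt_apply_eq_of_eqOn hs h1 (hasFDerivAt_const (0 : ℝ) y)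
      (fun z hz ↦ hK z hz a b) c
    simp at this
    linarith
  -- The formula defining the Christoffel symbols, cleared of its denominator and differentiated
  -- along `U`.
  have key2 : ∀ c : E, 2 * (fderiv ℝ g y (U y) (christoffel g y a b) c
      + g y (fderiv ℝ (christoffel g) y (U y) a b) c) = fderiv ℝ (fderiv ℝ g) y (U y) a b c
      + fderiv ℝ (fderiv ℝ g) y (U y) b a c - fderiv ℝ (fderiv ℝ g) y (U y) c a b := by
    intro c
    have ca := hasFDerivAt_const (𝕜 := ℝ) a y
    have cb := hasFDerivAt_const (𝕜 := ℝ) b y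
    have cc := hasFDerivAt_const (𝕜 := ℝ) c y
    have h1 := ((((hg2.clm_apply ca).clm_apply cb).clm_apply cc).add
      (((hg2.clm_apply cb).clm_apply ca).clm_apply cc)).sub
      (((hg2.clm_apply cc).clm_apply ca).clm_apply cb)
    have h2 := ((hg1.clm_apply ((hΓ.clm_apply ca).clm_apply cb)).clm_apply cc).const_mul 2
    have := hasFDerivAt_apply_eq_of_eqOn hs h2 h1 (fun z hz ↦ show 2 * _ = _ by
      rw [hg.apply_christoffel hz, mul_div_cancel₀ _ two_ne_zero]; rfl) (U y)
    simp at this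
    linarith
  refine hg.ext_left hy fun c ↦ ?_
  -- The Koszul combination `k1 + k2 - k3` isolates the second derivative of `U`, just as it
  -- isolates the Christoffel symbols from the derivatives of `g`. The Killing equation `k5` at
  -- `Γ(a, b)` turns the derivative of `g` along `U` into the last term of the statement.
  have k1 := key a b c
  have k2 := key b a c
  have k3 := key c a b
  have k4 := key2 c
  have k5 := hK y hy (christoffel g y a b) c
  rw [fderiv_fderiv_symm (hg.contDiffAt hy)] at k1 k2 k3
  rw [fderiv_fderiv_symm hUy a c, hg.symm y hy b] at k1
  rw [fderiv_fderiv_symm hUy b c, fderiv_fderiv_symm hUy b a, hg.symm y hy a] at k2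
  have e1 := hg.apply_christoffel hy (fderiv ℝ U y a) b c
  have e2 := hg.apply_christoffel hy a (fderiv ℝ U y b) c
  have e3 := hg.apply_christoffel hy a b (fderiv ℝ U y c)
  have s1 := hg.symm y hy a (fderiv ℝ (fderiv ℝ U) y c b)
  have s2 := hg.fderiv_symm hy c a (fderiv ℝ U y b)
  have s3 := hg.fderiv_symm hy b a (fderiv ℝ U y c)
  have s4 := hg.fderiv_symm hy a b (fderiv ℝ U y c)
  have s5 := hg.fderiv_symm hy b (fderiv ℝ U y a) c
  have s6 := hg.fderiv_symm hy a (fderiv ℝ U y b) c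
  simp only [map_sub, map_add, map_zero, add_apply, sub_apply, zero_apply]
  linarith

end IsMetricOn

end LocalMetric

/-! ### Algebra of the Newton transformations -/

section NewtonTransform

open Polynomial

variable {V : Type*} [AddCommGroup V] [Module ℝ V]

/-- The elementary symmetric functions of the eigenvalues of an operator. -/
def esymmEigenvalues [FiniteDimensional ℝ V] (A : V →ₗ[ℝ] V) (k : ℕ) : ℝ :=
  A.charpoly.roots.esymm k

/-- The Newton transformations of an operator. -/
def newtonTransform [FiniteDimensional ℝ V] (A : V →ₗ[ℝ] V) : ℕ → V →ₗ[ℝ] V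
  | 0 => LinearMap.id
  | r + 1 => esymmEigenvalues A (r + 1) • LinearMap.id - A ∘ₗ newtonTransform A r

variable [FiniteDimensional ℝ V] {A : V →ₗ[ℝ] V}

theorem esymmEigenvalues_zero : esymmEigenvalues A 0 = 1 := by
  simp [esymmEigenvalues, Multiset.esymm]

theorem newtonTransform_commute (r : ℕ) : Commute A (newtonTransform A r) := by
  induction r with
  | zero => exact Commute.one_right A
  | succ r ih =>
    exact ((Commute.one_right A).smul_right (esymmEigenvalues A (r + 1))).sub_right
      ((Commute.refl A).mul_right ih)

/-- `T_r` commutes with `A`, so cyclicity of the trace applies. This removes the commutator from the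
Hessian of the support function. -/
theorem trace_newtonTransform_commutator (r : ℕ) (B : V →ₗ[ℝ] V) :
    LinearMap.trace ℝ V (newtonTransform A r ∘ₗ (B ∘ₗ A - A ∘ₗ B)) = 0 := by
  have h : newtonTransform A r ∘ₗ A = A ∘ₗ newtonTransform A r :=
    (newtonTransform_commute (A := A) r).symm.eq
  rw [LinearMap.comp_sub, map_sub, ← LinearMap.comp_assoc B A, h, LinearMap.comp_assoc B _ A,
    LinearMap.trace_comp_comm' _ A, LinearMap.comp_assoc, sub_self]

/-- Vieta's formula. Splitting is essential: `esymmEigenvalues` sees only the real roots. -/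
theorem coeff_charpoly (hA : A.charpoly.Splits) {k : ℕ} (hk : k ≤ Module.finrank ℝ V) :
    A.charpoly.coeff (Module.finrank ℝ V - k) = (-1) ^ k * esymmEigenvalues A k := by
  rw [Polynomial.coeff_eq_esymm_roots_of_splits hA (by rw [A.charpoly_natDegree]; omega),
    A.charpoly_natDegree, A.charpoly_monic.leadingCoeff, one_mul, Nat.sub_sub_self hk]
  rfl

theorem charpoly_eq_sum (hA : A.charpoly.Splits) :
    A.charpoly = ∑ k ∈ Finset.range (Module.finrank ℝ V + 1),
      C ((-1) ^ k * esymmEigenvalues A k) * X ^ (Module.finrank ℝ V - k) := by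
  rw [A.charpoly.as_sum_range_C_mul_X_pow, A.charpoly_natDegree, ← Finset.sum_range_reflect]
  refine Finset.sum_congr rfl fun k hk ↦ ?_
  have hk : k ≤ Module.finrank ℝ V := Nat.lt_succ_iff.1 (Finset.mem_range.1 hk)
  rw [Nat.add_sub_cancel, coeff_charpoly hA hk]

theorem esymmEigenvalues_eq_zero {k : ℕ} (hk : Module.finrank ℝ V < k) :
    esymmEigenvalues A k = 0 := by
  have : Multiset.card A.charpoly.roots < k :=
    (A.charpoly.card_roots'.trans_eq A.charpoly_natDegree).trans_lt hk
  simp [esymmEigenvalues, Multiset.esymm, Multiset.powersetCard_eq_empty _ this]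

theorem newtonTransform_eq_sum (m : ℕ) : newtonTransform A m =
    ∑ k ∈ Finset.range (m + 1), esymmEigenvalues A k • (-A) ^ (m - k) := by
  induction m with
  | zero => simp [newtonTransform, esymmEigenvalues_zero]; rfl
  | succ m ih =>
    rw [Finset.sum_range_succ, newtonTransform, ih, Nat.sub_self, pow_zero, sub_eq_neg_add]
    congr 1
    change -(A * _) = _
    rw [Finset.mul_sum, ← Finset.sum_neg_distrib]
    refine Finset.sum_congr rfl fun k hk ↦ ?_
    have hk : k ≤ m := Nat.lt_succ_iff.1 (Finset.mem_range.1 hk)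
    rw [Nat.succ_sub hk, pow_succ', mul_smul_comm, neg_mul, smul_neg]

/-- For `n = dim V`, the expanded recursion gives `T_n = (-1)^n χ(A)`, where `χ` is the
characteristic polynomial, and this vanishes by Cayley–Hamilton. Beyond `n` the recursion keeps it
zero, as `S_k = 0` for `k > n`. -/
theorem newtonTransform_eq_zero (hA : A.charpoly.Splits) {m : ℕ} (hm : Module.finrank ℝ V ≤ m) :
    newtonTransform A m = 0 := by
  induction m, hm using Nat.le_induction with
  | base =>
    have h := A.aeval_self_charpoly
    rw [charpoly_eq_sum hA, map_sum] at h
    have h2 : newtonTransform A (Module.finrank ℝ V) = (-1 : ℝ) ^ (Module.finrank ℝ V) •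
      ∑ k ∈ Finset.range (Module.finrank ℝ V + 1), aeval A
        (C ((-1) ^ k * esymmEigenvalues A k) * X ^ (Module.finrank ℝ V - k)) := by
      rw [newtonTransform_eq_sum, Finset.smul_sum]
      refine Finset.sum_congr rfl fun k hk ↦ ?_
      obtain ⟨j, hj⟩ := Nat.exists_eq_add_of_le (Nat.lt_succ_iff.1 (Finset.mem_range.1 hk))
      rw [map_mul, aeval_C, map_pow, aeval_X, ← Algebra.smul_def, smul_smul, hj,
        Nat.add_sub_cancel_left, ← neg_one_smul ℝ A, _root_.smul_pow, smul_smul]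
      congr 1
      have h1 : ((-1 : ℝ) ^ k * (-1) ^ k) = 1 := by rw [← mul_pow]; simp
      linear_combination (-esymmEigenvalues A k * (-1) ^ j) * h1
    rw [h2, h, smul_zero]
  | succ m hm ih =>
    rw [newtonTransform, ih, esymmEigenvalues_eq_zero (Nat.lt_succ_of_le hm)]
    simp

/-- The polynomial `∑ (-1)^k λ^(m-1-k) T_k`, which for `m = dim V` is the adjugate of `λ - A`. -/
def newtonSum (A : V →ₗ[ℝ] V) (t : ℝ) (m : ℕ) : V →ₗ[ℝ] V :=
  ∑ k ∈ Finset.range m, ((-1) ^ k * t ^ (m - 1 - k)) • newtonTransform A k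

theorem newtonSum_succ (t : ℝ) (m : ℕ) :
    newtonSum A t (m + 1) = t • newtonSum A t m + (-1 : ℝ) ^ m • newtonTransform A m := by
  rw [newtonSum, Finset.sum_range_succ, newtonSum, Finset.smul_sum]
  congr 1
  · refine Finset.sum_congr rfl fun k hk ↦ ?_
    have hk := Finset.mem_range.1 hk
    rw [smul_smul, show m + 1 - 1 - k = (m - 1 - k) + 1 by omega, pow_succ]
    congr 1; ring
  · simp

/-- The product telescopes through `A T_k = S_{k+1} - T_{k+1}`; the last Newton transformation
remains as the error term. -/
theorem sub_mul_newtonSum (t : ℝ) (m : ℕ) :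
    (algebraMap ℝ (Module.End ℝ V) t - A) * newtonSum A t m =
      (∑ k ∈ Finset.range (m + 1), (-1) ^ k * esymmEigenvalues A k * t ^ (m - k)) •
        (1 : Module.End ℝ V) - (-1 : ℝ) ^ m • newtonTransform A m := by
  induction m with
  | zero => simp [newtonSum, esymmEigenvalues_zero, newtonTransform, Module.End.one_eq_id]
  | succ m ih =>
    rw [newtonSum_succ, mul_add, mul_smul_comm, ih, Finset.sum_range_succ _ (m + 1)]
    have : ∑ k ∈ Finset.range (m + 1), (-1) ^ k * esymmEigenvalues A k * t ^ (m + 1 - k) =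
        t * ∑ k ∈ Finset.range (m + 1), (-1) ^ k * esymmEigenvalues A k * t ^ (m - k) := by
      rw [Finset.mul_sum]
      refine Finset.sum_congr rfl fun k hk ↦ ?_
      rw [Nat.succ_sub (Nat.lt_succ_iff.1 (Finset.mem_range.1 hk)), pow_succ]
      ring
    rw [this, newtonTransform]
    ext v
    simp [pow_succ]
    module

/-- At `m = dim V` the error term vanishes, so `newtonSum` serves as the adjugate in Jacobi's
formula. -/
theorem sub_mul_newtonSum_finrank (hA : A.charpoly.Splits) (t : ℝ) :
    (algebraMap ℝ (Module.End ℝ V) t - A) * newtonSum A t (Module.finrank ℝ V) =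
      A.charpoly.eval t • (1 : Module.End ℝ V) := by
  rw [sub_mul_newtonSum, newtonTransform_eq_zero hA le_rfl, smul_zero, sub_zero]
  conv_rhs => rw [charpoly_eq_sum hA]
  simp [eval_finsetSum]

end NewtonTransform

/-! ### Derivative of the elementary symmetric functions of an operator -/

section Derivative

variable {V : Type*} [NormedAddCommGroup V] [NormedSpace ℝ V] [FiniteDimensional ℝ V]
  {F : Type*} [NormedAddCommGroup F] [NormedSpace ℝ F]

theorem differentiable_det :
    Differentiable ℝ (fun B : V →L[ℝ] V ↦ LinearMap.det (B : V →ₗ[ℝ] V)) := by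
  let b := Module.finBasis ℝ V
  have h (B : V →L[ℝ] V) : LinearMap.det (B : V →ₗ[ℝ] V) =
      ∑ σ : Equiv.Perm (Fin (Module.finrank ℝ V)), ((Equiv.Perm.sign σ : ℤ) : ℝ) *
        ∏ i, LinearMap.toContinuousLinearMap (b.coord (σ i)) (B (b i)) := by
    rw [← LinearMap.det_toMatrix b, Matrix.det_apply']
    simp [LinearMap.toMatrix_apply]
  simp only [h]
  fun_prop

/-- The determinant is `1 + t Tr B` plus `t²` times a polynomial in `t`, and the last term has zero
derivative at `0`. -/
theorem hasDerivAt_det_one_add_smul (B : V →ₗ[ℝ] V) :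
    HasDerivAt (fun t : ℝ ↦ LinearMap.det (1 + t • B)) (LinearMap.trace ℝ V B) 0 := by
  let b := Module.finBasis ℝ V
  have h (t : ℝ) := Matrix.det_one_add_smul t (LinearMap.toMatrix b b B)
  have h1 (t : ℝ) : LinearMap.det (1 + t • B) = Matrix.det (1 + t • LinearMap.toMatrix b b B) := by
    rw [← LinearMap.det_toMatrix b, map_add, map_smul, LinearMap.toMatrix_one]
  simp only [h1, h, LinearMap.trace_eq_matrix_trace ℝ b]
  have hp := (Polynomial.hasDerivAt ((1 + (Polynomial.X : Polynomial ℝ) •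
    (LinearMap.toMatrix b b B).map Polynomial.C).det.divX.divX) 0)
  have := ((((hasDerivAt_id (0 : ℝ)).const_mul (LinearMap.toMatrix b b B).trace).const_add 1).add
    (hp.mul ((hasDerivAt_id (0 : ℝ)).pow 2)))
  exact this.congr_deriv (by simp)

/-- Jacobi's formula for the derivative of the determinant. -/
theorem fderiv_det_of_mul_eq {C : V →L[ℝ] V} {P : V →ₗ[ℝ] V}
    (h : (C : V →ₗ[ℝ] V) * P = LinearMap.det (C : V →ₗ[ℝ] V) • (1 : Module.End ℝ V))
    (h0 : LinearMap.det (C : V →ₗ[ℝ] V) ≠ 0) (B : V →L[ℝ] V) :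
    fderiv ℝ (fun B : V →L[ℝ] V ↦ LinearMap.det (B : V →ₗ[ℝ] V)) C B =
      LinearMap.trace ℝ V (P ∘ₗ B) := by
  set d := LinearMap.det (C : V →ₗ[ℝ] V) with hd
  have hC : (C : V →ₗ[ℝ] V) * (d⁻¹ • P) = 1 := by
    rw [mul_smul_comm, h, smul_smul, inv_mul_cancel₀ h0, one_smul]
  have hC' : (d⁻¹ • P) * (C : V →ₗ[ℝ] V) = 1 := mul_eq_one_comm.1 hC
  have h1 : HasDerivAt (fun t : ℝ ↦ LinearMap.det ((C + t • B : V →L[ℝ] V) : V →ₗ[ℝ] V))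
      (fderiv ℝ (fun B : V →L[ℝ] V ↦ LinearMap.det (B : V →ₗ[ℝ] V)) C B) 0 := by
    have e : HasDerivAt (fun t : ℝ ↦ C + t • B) B 0 := by
      simpa using ((hasDerivAt_id (0 : ℝ)).smul_const B).const_add C
    have hdet := (differentiable_det (V := V) (C + (0 : ℝ) • B)).hasFDerivAt
    rw [zero_smul, add_zero] at hdet
    exact HasFDerivAt.comp_hasDerivAt (0 : ℝ) (by simpa using hdet) e
  -- Factor `C + tB = C (1 + t C⁻¹ B)`, with `C⁻¹ = d⁻¹ P`, to reduce to the derivative at the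
  -- identity.
  have h2 : HasDerivAt (fun t : ℝ ↦ LinearMap.det ((C + t • B : V →L[ℝ] V) : V →ₗ[ℝ] V))
      (d * LinearMap.trace ℝ V ((d⁻¹ • P) ∘ₗ B)) 0 := by
    refine ((hasDerivAt_det_one_add_smul ((d⁻¹ • P) ∘ₗ B)).const_mul d).congr_of_eventuallyEq
      (Filter.Eventually.of_forall fun t ↦ ?_)
    dsimp only
    rw [hd, ← map_mul, mul_add, mul_one, mul_smul_comm]
    congr 1
    have : (C : V →ₗ[ℝ] V) * ((d⁻¹ • P) ∘ₗ (B : V →ₗ[ℝ] V)) = B := by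
      change (C : V →ₗ[ℝ] V) * ((d⁻¹ • P) * (B : V →ₗ[ℝ] V)) = B
      rw [← mul_assoc, hC, one_mul]
    rw [this]
    rfl
  rw [h1.unique h2, LinearMap.smul_comp, map_smul, smul_eq_mul, mul_inv_cancel_left₀ h0]

open Polynomial in
/-- If the `(r+1)`-st elementary symmetric function of the eigenvalues is constant, then the
derivative of the operator is orthogonal to its `r`-th Newton transformation. -/
theorem trace_newtonTransform_comp_eq_zero {A : F → V →L[ℝ] V} {A' : F →L[ℝ] V →L[ℝ] V} {u : F}
    (hA : HasFDerivAt A A' u) {s : Set F} (hs : s ∈ nhds u)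
    (hsplit : ∀ z ∈ s, (A z : V →ₗ[ℝ] V).charpoly.Splits) {r : ℕ} {c : ℝ}
    (hconst : ∀ z ∈ s, esymmEigenvalues (A z : V →ₗ[ℝ] V) (r + 1) = c) (a : F) :
    LinearMap.trace ℝ V (newtonTransform (A u : V →ₗ[ℝ] V) r ∘ₗ (A' a : V →ₗ[ℝ] V)) = 0 := by
  have hus := mem_of_mem_nhds hs
  set n := Module.finrank ℝ V with hn
  -- For `r ≥ n` there is nothing to differentiate: `T_r = 0`.
  rcases le_or_gt n r with hr | hr
  · rw [newtonTransform_eq_zero (hsplit u hus) hr, LinearMap.zero_comp, map_zero]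
  -- Take `n + 1` sample points that are not eigenvalues of `A u`. A polynomial of degree at most
  -- `n` is determined by its values there, so each coefficient is a fixed linear combination of
  -- them; off the eigenvalues `x - A u` is invertible and Jacobi's formula applies.
  obtain ⟨t, ht, htc⟩ := ((A u : V →ₗ[ℝ] V).charpoly.roots.toFinset.finite_toSet
    |>.infinite_compl).exists_subset_card_eq (n + 1)
  have hinj : Set.InjOn (id : ℝ → ℝ) t := Function.injective_id.injOn
  have hcoeff (p : ℝ[X]) (hp : p.natDegree ≤ n) (j : ℕ) :
      p.coeff j = ∑ i ∈ t, p.eval i * (Lagrange.basis t id i).coeff j := by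
    have := Lagrange.eq_interpolate (v := id) (f := p) hinj (by
      rw [htc]
      exact (degree_le_of_natDegree_le hp).trans_lt (by exact_mod_cast Nat.lt_succ_self n))
    conv_lhs => rw [this]
    simp [Lagrange.interpolate_apply]
  have hder (x : ℝ) (hx : x ∈ t) : HasFDerivAt (fun z ↦ (A z : V →ₗ[ℝ] V).charpoly.eval x)
      (-(fderiv ℝ (fun B : V →L[ℝ] V ↦ LinearMap.det (B : V →ₗ[ℝ] V))
        (x • ContinuousLinearMap.id ℝ V - A u)) ∘L A') u := by
    have h1 := (differentiable_det (V := V) (x • ContinuousLinearMap.id ℝ V - A u)).hasFDerivAt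
    have h2 := h1.comp u (hA.const_sub (x • ContinuousLinearMap.id ℝ V))
    refine (h2.congr_of_eventuallyEq (Filter.Eventually.of_forall fun z ↦ ?_)).congr_fderiv ?_
    · simp only [LinearMap.eval_charpoly]; rfl
    · ext; simp
  have hval (x : ℝ) (hx : x ∈ t) : fderiv ℝ (fun B : V →L[ℝ] V ↦ LinearMap.det (B : V →ₗ[ℝ] V))
        (x • ContinuousLinearMap.id ℝ V - A u) (A' a) =
      LinearMap.trace ℝ V (newtonSum (A u : V →ₗ[ℝ] V) x n ∘ₗ (A' a : V →ₗ[ℝ] V)) := by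
    have hdet : LinearMap.det ((x • ContinuousLinearMap.id ℝ V - A u : V →L[ℝ] V) : V →ₗ[ℝ] V) =
        (A u : V →ₗ[ℝ] V).charpoly.eval x := by
      rw [LinearMap.eval_charpoly]; rfl
    refine fderiv_det_of_mul_eq ?_ ?_ _
    · rw [hdet]
      exact sub_mul_newtonSum_finrank (hsplit u hus) x
    · rw [hdet]
      intro h0
      exact ht hx (by simp [(A u : V →ₗ[ℝ] V).charpoly_monic.ne_zero, h0])
  have hsum : HasFDerivAt (fun z ↦ ∑ i ∈ t, (A z : V →ₗ[ℝ] V).charpoly.eval i *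
      (Lagrange.basis t id i).coeff (n - (r + 1))) _ u :=
    HasFDerivAt.fun_sum fun i hi ↦ (hder i hi).mul_const _
  have h0 := hasFDerivAt_apply_eq_of_eqOn hs hsum
    (hasFDerivAt_const ((-1 : ℝ) ^ (r + 1) * c) u) (fun z hz ↦ by
      rw [← hcoeff _ (LinearMap.charpoly_natDegree _).le, coeff_charpoly (hsplit z hz) hr,
        hconst z hz]) a
  -- The values of this polynomial at the sample points are, up to sign, the derivatives of the
  -- values of the characteristic polynomial. The same coefficient functional therefore gives minus
  -- the derivative of a constant coefficient.
  have hq := hcoeff (∑ k ∈ Finset.range n, C ((-1) ^ k * LinearMap.trace ℝ V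
      (newtonTransform (A u : V →ₗ[ℝ] V) k ∘ₗ (A' a : V →ₗ[ℝ] V))) * X ^ (n - 1 - k))
      (natDegree_sum_le_of_forall_le _ _ fun k hk ↦ (natDegree_C_mul_X_pow_le _ _).trans (by omega))
      (n - (r + 1))
  have hev (x : ℝ) : (∑ k ∈ Finset.range n, C ((-1) ^ k * LinearMap.trace ℝ V
      (newtonTransform (A u : V →ₗ[ℝ] V) k ∘ₗ (A' a : V →ₗ[ℝ] V))) * X ^ (n - 1 - k)).eval x =
      LinearMap.trace ℝ V (newtonSum (A u : V →ₗ[ℝ] V) x n ∘ₗ (A' a : V →ₗ[ℝ] V)) := by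
    rw [eval_finsetSum, newtonSum, ← Module.End.mul_eq_comp, Finset.sum_mul, map_sum]
    refine Finset.sum_congr rfl fun k _ ↦ ?_
    rw [smul_mul_assoc, map_smul, Module.End.mul_eq_comp]
    simp
    ring
  have hz : ∑ i ∈ t, LinearMap.trace ℝ V (newtonSum (A u : V →ₗ[ℝ] V) i n ∘ₗ
      (A' a : V →ₗ[ℝ] V)) * (Lagrange.basis t id i).coeff (n - (r + 1)) = 0 := by
    rw [← neg_eq_zero, ← Finset.sum_neg_distrib]
    rw [zero_apply, sum_apply] at h0
    refine Eq.trans (Finset.sum_congr rfl fun i hi ↦ ?_) h0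
    rw [← hval i hi]
    simp [mul_comm]
  simp only [hev] at hq
  -- Since `n - 1 - r = n - (r + 1)`, only the summand `k = r` contributes to this coefficient.
  rw [hz, finsetSum_coeff, Finset.sum_eq_single r] at hq
  · rw [coeff_C_mul_X_pow, if_pos (by omega)] at hq
    simpa using hq
  · intro k hk hkr
    have := Finset.mem_range.1 hk
    rw [coeff_C_mul_X_pow, if_neg (by omega)]
  · intro h
    exact absurd (Finset.mem_range.2 hr) h

end Derivative

/-! ### Covariant derivatives along maps and the Hessian identity in coordinates -/

section LocalHypersurface

variable {E : Type*} [NormedAddCommGroup E] [NormedSpace ℝ E]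
  {F : Type*} [NormedAddCommGroup F] [NormedSpace ℝ F]

theorem hasFDerivAt_of_contDiffOn {f : F → E} {s : Set F} (hs : IsOpen s)
    (hf : ContDiffOn ℝ ∞ f s) {u : F} (hu : u ∈ s) : HasFDerivAt f (fderiv ℝ f u) u :=
  ((hf.contDiffAt (hs.mem_nhds hu)).differentiableAt (by simp)).hasFDerivAt

theorem hasFDerivAt_fderiv_of_contDiffOn {f : F → E} {s : Set F} (hs : IsOpen s)
    (hf : ContDiffOn ℝ ∞ f s) {u : F} (hu : u ∈ s) :
    HasFDerivAt (fderiv ℝ f) (fderiv ℝ (fderiv ℝ f) u) u :=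
  hasFDerivAt_of_contDiffOn hs (hf.fderiv_of_isOpen hs (by simp)) hu

/-- The covariant derivative of a vector field along a map between vector spaces. -/
def covAlong (g : E → E →L[ℝ] E →L[ℝ] ℝ) (φ V : F → E) (u : F) : F →L[ℝ] E :=
  fderiv ℝ V u + (christoffel g (φ u)).flip (V u) ∘L fderiv ℝ φ u

/-- The second fundamental form of a map between vector spaces, where the source has its flat
connection: `(a, b) ↦ ∇_a (dφ b)`. -/
def secondForm (g : E → E →L[ℝ] E →L[ℝ] ℝ) (φ : F → E) (u : F) : F →L[ℝ] F →L[ℝ] E :=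
  fderiv ℝ (fderiv ℝ φ) u + (christoffel g (φ u)).bilinearComp (fderiv ℝ φ u) (fderiv ℝ φ u)

/-- The covariant derivative of a vector field on a vector space. -/
def covField (g : E → E →L[ℝ] E →L[ℝ] ℝ) (U : E → E) (y : E) : E →L[ℝ] E :=
  fderiv ℝ U y + (christoffel g y).flip (U y)

variable {g : E → E →L[ℝ] E →L[ℝ] ℝ} {O : Set E} {s : Set F} {φ : F → E} {u : F}

theorem covAlong_apply (V : F → E) (a : F) :
    covAlong g φ V u a = fderiv ℝ V u a + christoffel g (φ u) (fderiv ℝ φ u a) (V u) := by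
  simp [covAlong]

theorem secondForm_apply (a b : F) : secondForm g φ u a b =
    fderiv ℝ (fderiv ℝ φ) u a b + christoffel g (φ u) (fderiv ℝ φ u a) (fderiv ℝ φ u b) := by
  simp [secondForm]

theorem covField_apply (U : E → E) (y a : E) :
    covField g U y a = fderiv ℝ U y a + christoffel g y a (U y) := by
  simp [covField]

theorem covAlong_congr {V W : F → E} (hs : s ∈ nhds u) (h : ∀ z ∈ s, V z = W z) :
    covAlong g φ V u = covAlong g φ W u := by
  have : V =ᶠ[nhds u] W := by filter_upwards [hs] with z hz using h z hz
  rw [covAlong, covAlong, this.fderiv_eq, this.eq_of_nhds]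

/-- The product rule. As the source carries its flat connection, the first term is the plain
derivative of the components and `secondForm` absorbs the rest, including its tangential part. -/
theorem covAlong_fderiv {c : F → F} {c' : F →L[ℝ] F} (hs : IsOpen s) (hφ : ContDiffOn ℝ ∞ φ s)
    (hu : u ∈ s) (hc : HasFDerivAt c c' u) (a : F) :
    covAlong g φ (fun z ↦ fderiv ℝ φ z (c z)) u a =
      fderiv ℝ φ u (c' a) + secondForm g φ u a (c u) := by
  rw [covAlong_apply, secondForm_apply,
    ((hasFDerivAt_fderiv_of_contDiffOn hs hφ hu).clm_apply hc).fderiv]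
  simp [add_assoc]

theorem covAlong_neg (V : F → E) : covAlong g φ (fun z ↦ -V z) u = -covAlong g φ V u := by
  ext a
  simp [covAlong_apply]
  abel

theorem covAlong_comp {U : E → E} (hφ : DifferentiableAt ℝ φ u)
    (hU : DifferentiableAt ℝ U (φ u)) :
    covAlong g φ (fun z ↦ U (φ z)) u = covField g U (φ u) ∘L fderiv ℝ φ u := by
  ext a
  have h : HasFDerivAt (fun z ↦ U (φ z)) (fderiv ℝ U (φ u) ∘L fderiv ℝ φ u) u :=
    hU.hasFDerivAt.comp u hφ.hasFDerivAt
  rw [covAlong_apply, h.fderiv]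
  simp [covField_apply]

theorem curvature_add_smul (y a b c d : E) (t : ℝ) :
    curvature g y a (b + t • c) d = curvature g y a b d + t • curvature g y a c d := by
  simp only [curvature, map_add, map_smul, add_apply, smul_apply]
  module

variable [FiniteDimensional ℝ E]

namespace IsMetricOn

/-- Torsion-freeness together with symmetry of second derivatives. -/
theorem secondForm_symm (hg : IsMetricOn g O) (hs : IsOpen s) (hφ : ContDiffOn ℝ ∞ φ s)
    (hmaps : Set.MapsTo φ s O) (hu : u ∈ s) (a b : F) :
    secondForm g φ u a b = secondForm g φ u b a := by
  rw [secondForm_apply, secondForm_apply, hg.christoffel_symm (hmaps hu),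
    fderiv_fderiv_symm (hφ.contDiffAt (hs.mem_nhds hu))]

/-- Metric compatibility of the covariant derivative along a map. -/
theorem hasFDerivAt_inner (hg : IsMetricOn g O) (hs : IsOpen s) (hφ : ContDiffOn ℝ ∞ φ s)
    (hmaps : Set.MapsTo φ s O) (hu : u ∈ s) {V W : F → E} (hV : DifferentiableAt ℝ V u)
    (hW : DifferentiableAt ℝ W u) :
    HasFDerivAt (fun z ↦ g (φ z) (V z) (W z)) ((g (φ u)).flip (W u) ∘L covAlong g φ V u +
      g (φ u) (V u) ∘L covAlong g φ W u) u := by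
  have hO := hmaps hu
  have := (((hg.differentiableAt hO).hasFDerivAt.comp u
    (hasFDerivAt_of_contDiffOn hs hφ hu)).clm_apply hV.hasFDerivAt).clm_apply hW.hasFDerivAt
  refine HasFDerivAt.congr_fderiv this ?_
  ext a
  simp [covAlong_apply, hg.fderiv_eq hO]
  ring

theorem hasFDerivAt_covAlong (hg : IsMetricOn g O) (hs : IsOpen s) (hφ : ContDiffOn ℝ ∞ φ s)
    (hmaps : Set.MapsTo φ s O) (hu : u ∈ s) {V : F → E} (hV : ContDiffOn ℝ ∞ V s) (b : F) :
    HasFDerivAt (fun z ↦ covAlong g φ V z b) ((fderiv ℝ (fderiv ℝ V) u).flip b +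
      (christoffel g (φ u) (fderiv ℝ φ u b) ∘L fderiv ℝ V u +
        ((christoffel g (φ u) ∘L (fderiv ℝ (fderiv ℝ φ) u).flip b) +
        (fderiv ℝ (christoffel g) (φ u) ∘L fderiv ℝ φ u).flip (fderiv ℝ φ u b)).flip (V u))) u := by
  have cb := hasFDerivAt_const (𝕜 := ℝ) b u
  have h1 := (hasFDerivAt_fderiv_of_contDiffOn hs hV hu).clm_apply cb
  have h2 := (((hg.differentiableAt_christoffel (hmaps hu)).hasFDerivAt.comp u
    (hasFDerivAt_of_contDiffOn hs hφ hu)).clm_apply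
    ((hasFDerivAt_fderiv_of_contDiffOn hs hφ hu).clm_apply cb)).clm_apply
    (hasFDerivAt_of_contDiffOn hs hV hu)
  have h3 := h1.add h2
  refine (h3.congr_of_eventuallyEq (Filter.Eventually.of_forall fun z ↦ ?_)).congr_fderiv ?_
  · exact covAlong_apply V b
  · simp

/-- The curvature of the covariant derivative along a map. -/
theorem covAlong_covAlong_sub (hg : IsMetricOn g O) (hs : IsOpen s) (hφ : ContDiffOn ℝ ∞ φ s)
    (hmaps : Set.MapsTo φ s O) (hu : u ∈ s) {V : F → E} (hV : ContDiffOn ℝ ∞ V s) (a b : F) :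
    covAlong g φ (fun z ↦ covAlong g φ V z b) u a - covAlong g φ (fun z ↦ covAlong g φ V z a) u b =
      curvature g (φ u) (fderiv ℝ φ u a) (fderiv ℝ φ u b) (V u) := by
  rw [covAlong_apply, covAlong_apply (fun z ↦ covAlong g φ V z a),
    (hg.hasFDerivAt_covAlong hs hφ hmaps hu hV b).fderiv,
    (hg.hasFDerivAt_covAlong hs hφ hmaps hu hV a).fderiv]
  simp [covAlong_apply, curvature, fderiv_fderiv_symm (hV.contDiffAt (hs.mem_nhds hu)) a b,
    fderiv_fderiv_symm (hφ.contDiffAt (hs.mem_nhds hu)) a b]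
  abel

/-- The second covariant derivative of a Killing field along a map. -/
theorem covAlong_covAlong_killing (hg : IsMetricOn g O) (hs : IsOpen s) (hφ : ContDiffOn ℝ ∞ φ s)
    (hmaps : Set.MapsTo φ s O) (hu : u ∈ s) {U : E → E} (hU : ContDiffOn ℝ ∞ U O)
    (hK : ∀ y ∈ O, ∀ a b, fderiv ℝ g y (U y) a b + g y (fderiv ℝ U y a) b
      + g y a (fderiv ℝ U y b) = 0) (a b : F) :
    covAlong g φ (fun z ↦ covAlong g φ (fun z ↦ U (φ z)) z b) u a =
      curvature g (φ u) (fderiv ℝ φ u a) (U (φ u)) (fderiv ℝ φ u b)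
        + covField g U (φ u) (secondForm g φ u a b) := by
  have hO := hmaps hu
  have hφ' {z : F} (hz : z ∈ s) := hasFDerivAt_of_contDiffOn hs hφ hz
  have hU' {y : E} (hy : y ∈ O) := hasFDerivAt_of_contDiffOn hg.isOpen hU hy
  have hφ2 := (hasFDerivAt_fderiv_of_contDiffOn hs hφ hu).clm_apply
    (hasFDerivAt_const (𝕜 := ℝ) b u)
  have h1 := ((hasFDerivAt_fderiv_of_contDiffOn hg.isOpen hU hO).comp u (hφ' hu)).clm_apply hφ2
  have h2 := (((hg.differentiableAt_christoffel hO).hasFDerivAt.comp u (hφ' hu)).clm_apply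
    hφ2).clm_apply ((hU' hO).comp u (hφ' hu))
  have h3 : HasFDerivAt (fun z ↦ fderiv ℝ U (φ z) (fderiv ℝ φ z b) +
      christoffel g (φ z) (fderiv ℝ φ z b) (U (φ z))) _ u := h1.add h2
  rw [covAlong_congr (W := fun z ↦ fderiv ℝ U (φ z) (fderiv ℝ φ z b) +
      christoffel g (φ z) (fderiv ℝ φ z b) (U (φ z))) (hs.mem_nhds hu) fun z hz ↦ by
    rw [covAlong_comp (hφ' hz).differentiableAt (hU' (hmaps hz)).differentiableAt]
    simp [covField_apply], covAlong_apply, h3.fderiv]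
  -- The difference of the two sides is exactly the Lie derivative of the Christoffel symbols along
  -- `U`.
  have := hg.lieDerivative_christoffel_eq_zero hU hK hO (fderiv ℝ φ u a) (fderiv ℝ φ u b)
  rw [← sub_eq_zero, ← this]
  simp only [curvature, covField_apply, secondForm_apply, map_add, add_apply,
    ContinuousLinearMap.comp_apply, ContinuousLinearMap.flip_apply, zero_apply, map_zero,
    Function.comp_apply, hg.christoffel_symm hO _ (U (φ u)),
    hg.fderiv_christoffel_symm hO _ (U (φ u)) (fderiv ℝ φ u b),
    hg.christoffel_symm hO (fderiv ℝ φ u b) (fderiv ℝ U (φ u) (fderiv ℝ φ u a))]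
  abel

/-- The Killing equation, once metric compatibility has replaced the derivative of `g` by
Christoffel symbols. -/
theorem apply_covField_skew (hg : IsMetricOn g O) {U : E → E}
    (hK : ∀ y ∈ O, ∀ a b, fderiv ℝ g y (U y) a b + g y (fderiv ℝ U y a) b
      + g y a (fderiv ℝ U y b) = 0) {y : E} (hy : y ∈ O) (a b : E) :
    g y (covField g U y a) b = -g y a (covField g U y b) := by
  have := hK y hy a b
  rw [hg.fderiv_eq hy] at this
  simp only [covField_apply, hg.christoffel_symm hy _ (U y), map_add, add_apply]
  linarith

variable [FiniteDimensional ℝ F]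

/-- The Hessian of the support function of a Killing field along a hypersurface: up to a commutator
with the shape operator, it is `-f A² - f R(N) - ∇_X A`, where `X` is the tangential part. -/
theorem hessian_support_function (hg : IsMetricOn g O) (hs : IsOpen s) (hφ : ContDiffOn ℝ ∞ φ s)
    (hmaps : Set.MapsTo φ s O) (hu : u ∈ s) {U : E → E} (hU : ContDiffOn ℝ ∞ U O)
    (hK : ∀ y ∈ O, ∀ a b, fderiv ℝ g y (U y) a b + g y (fderiv ℝ U y a) b
      + g y a (fderiv ℝ U y b) = 0)
    {N : F → E} (hN : ContDiffOn ℝ ∞ N s) (hN1 : g (φ u) (N u) (N u) = 1)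
    (hNφ : ∀ z ∈ s, ∀ a, g (φ z) (fderiv ℝ φ z a) (N z) = 0)
    (hinj : Function.Injective (fderiv ℝ φ u))
    (hspan : ∀ w, ∃ v : F, ∃ t : ℝ, w = fderiv ℝ φ u v + t • N u)
    {A : F → F →L[ℝ] F} {A' : F →L[ℝ] F →L[ℝ] F} (hA' : HasFDerivAt A A' u)
    (hA : ∀ z ∈ s, ∀ a, covAlong g φ N z a = -fderiv ℝ φ z (A z a))
    {G : F → F} (hGd : DifferentiableAt ℝ G u)
    (hG : ∀ z ∈ s, ∀ b, g (φ z) (fderiv ℝ φ z (G z)) (fderiv ℝ φ z b) =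
      fderiv ℝ (fun z ↦ g (φ z) (U (φ z)) (N z)) z b)
    {H R : F →ₗ[ℝ] F}
    (hH : ∀ a b, g (φ u) (fderiv ℝ φ u (H a)) (fderiv ℝ φ u b) =
      g (φ u) (covAlong g φ (fun z ↦ fderiv ℝ φ z (G z)) u a) (fderiv ℝ φ u b))
    (hR : ∀ a b, g (φ u) (fderiv ℝ φ u (R a)) (fderiv ℝ φ u b) =
      g (φ u) (curvature g (φ u) (fderiv ℝ φ u a) (N u) (N u)) (fderiv ℝ φ u b)) :
    ∃ (X : F) (B : F →ₗ[ℝ] F), H = B ∘ₗ (A u : F →ₗ[ℝ] F) - (A u : F →ₗ[ℝ] F) ∘ₗ B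
      - (A' X : F →ₗ[ℝ] F) - g (φ u) (U (φ u)) (N u) • (A u : F →ₗ[ℝ] F) ∘ₗ (A u : F →ₗ[ℝ] F)
      - g (φ u) (U (φ u)) (N u) • R := by
  have hO := hmaps hu
  have hsu := hs.mem_nhds hu
  have hφ' {z : F} (hz : z ∈ s) := hasFDerivAt_of_contDiffOn hs hφ hz
  have hφ2 {z : F} (hz : z ∈ s) := hasFDerivAt_fderiv_of_contDiffOn hs hφ hz
  have hN' {z : F} (hz : z ∈ s) := hasFDerivAt_of_contDiffOn hs hN hz
  have hU' {y : E} (hy : y ∈ O) := hasFDerivAt_of_contDiffOn hg.isOpen hU hy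
  have hW {z : F} (hz : z ∈ s) : HasFDerivAt (fun z ↦ U (φ z)) _ z :=
    (hU' (hmaps hz)).comp z (hφ' hz)
  have hWs : ContDiffOn ℝ ∞ (fun z ↦ U (φ z)) s := hU.comp hφ hmaps
  set f := g (φ u) (U (φ u)) (N u) with hf
  set S := secondForm g φ u with hS
  set T := fderiv ℝ φ u with hT
  set W : F → E := fun z ↦ U (φ z)
  have sy := hg.symm (φ u) hO
  have hSsymm := hg.secondForm_symm hs hφ hmaps hu
  have hAb (b : F) : HasFDerivAt (fun z ↦ A z b) (A'.flip b) u := by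
    simpa using hA'.clm_apply (hasFDerivAt_const (𝕜 := ℝ) b u)
  have dTA (a b : F) : covAlong g φ (fun z ↦ fderiv ℝ φ z (A z b)) u a =
      T (A' a b) + S a (A u b) := by
    rw [covAlong_fderiv hs hφ hu (hAb b)]; rfl
  have dT (a b : F) : covAlong g φ (fun z ↦ fderiv ℝ φ z b) u a = S a b := by
    rw [covAlong_fderiv hs hφ hu (hasFDerivAt_const b u)]; simp [hS]
  have diffT (b : F) : DifferentiableAt ℝ (fun z ↦ fderiv ℝ φ z b) u :=
    ((hφ2 hu).clm_apply (hasFDerivAt_const b u)).differentiableAt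
  have diffTA (b : F) : DifferentiableAt ℝ (fun z ↦ fderiv ℝ φ z (A z b)) u :=
    ((hφ2 hu).clm_apply (hAb b)).differentiableAt
  -- the tangential projection
  have hpos : ∀ a, a ≠ 0 → 0 < (g (φ u)).bilinearComp T T a a := fun a ha ↦
    hg.pos _ hO _ fun h ↦ ha (hinj (by simpa using h))
  let P : E →L[ℝ] F := ((g (φ u)).bilinearComp T T).inverse ∘L
    (ContinuousLinearMap.compL ℝ F E ℝ).flip T ∘L g (φ u)
  have hP (w : E) (c : F) : g (φ u) (T (P w)) (T c) = g (φ u) w (T c) := by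
    have := apply_inverse_of_isInvertible (isInvertible_of_pos hpos)
      ((ContinuousLinearMap.compL ℝ F E ℝ).flip T (g (φ u) w))
    exact DFunLike.congr_fun this c
  have hTN (c : F) : g (φ u) (T c) (N u) = 0 := hNφ u hu c
  have hText {x y : F} (h : ∀ b, g (φ u) (T x) (T b) = g (φ u) (T y) (T b)) : x = y := by
    refine hinj (hg.ext_left hO fun c ↦ ?_)
    obtain ⟨c, t, rfl⟩ := hspan c
    rw [map_add, map_add, map_smul, map_smul, hTN, hTN, h]
  have hdec (w : E) : w = T (P w) + g (φ u) w (N u) • N u := by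
    obtain ⟨v, t, rfl⟩ := hspan w
    have h1 : P (T v + t • N u) = v := by
      refine hText fun c ↦ ?_
      rw [hP, map_add, add_apply, map_smul, smul_apply, sy (N u), hTN, smul_zero, add_zero]
    rw [h1]
    simp [hTN, hN1]
  set X := P (U (φ u)) with hX
  have hWu : U (φ u) = T X + f • N u := hdec _
  -- the Weingarten equation
  have hII (a b : F) : g (φ u) (S a b) (N u) = g (φ u) (T (A u a)) (T b) := by
    have := hasFDerivAt_apply_eq_of_eqOn hsu (hg.hasFDerivAt_inner hs hφ hmaps hu (diffT b)
      (hN' hu).differentiableAt) (hasFDerivAt_const 0 u) (fun z hz ↦ hNφ z hz b) a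
    simp [dT, hA u hu] at this
    rw [sy (T (A u a))]
    linarith
  -- Self-adjointness is needed at every nearby `z`, not only at `u`, because it is differentiated
  -- next.
  have hAsymm {z : F} (hz : z ∈ s) (a b : F) : g (φ z) (fderiv ℝ φ z (A z a)) (fderiv ℝ φ z b) =
      g (φ z) (fderiv ℝ φ z (A z b)) (fderiv ℝ φ z a) := by
    have key (a b : F) : g (φ z) (secondForm g φ z a b) (N z) =
        g (φ z) (fderiv ℝ φ z (A z a)) (fderiv ℝ φ z b) := by
      have := hasFDerivAt_apply_eq_of_eqOn (hs.mem_nhds hz) (hg.hasFDerivAt_inner hs hφ hmaps hz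
        ((hφ2 hz).clm_apply (hasFDerivAt_const b z)).differentiableAt
        (hN' hz).differentiableAt) (hasFDerivAt_const 0 z) (fun z hz ↦ hNφ z hz b) a
      simp [covAlong_fderiv hs hφ hz (hasFDerivAt_const b z), hA z hz] at this
      rw [hg.symm _ (hmaps hz) (fderiv ℝ φ z (A z a))]
      linarith
    rw [← key, ← key, hg.secondForm_symm hs hφ hmaps hz]
  -- the derivative of the shape operator is symmetric
  have hA'symm (a b c : F) :
      g (φ u) (T (A' a c) + S a (A u c)) (T b) + g (φ u) (T (A u c)) (S a b) =
      g (φ u) (T (A' a b) + S a (A u b)) (T c) + g (φ u) (T (A u b)) (S a c) := by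
    have := hasFDerivAt_apply_eq_of_eqOn hsu
      (hg.hasFDerivAt_inner hs hφ hmaps hu (diffTA c) (diffT b))
      (hg.hasFDerivAt_inner hs hφ hmaps hu (diffTA b) (diffT c)) (fun z hz ↦ hAsymm hz c b) a
    simpa [dT, dTA, ← hT] using this
  -- the Codazzi equation
  have hcod (a b : F) : curvature g (φ u) (T a) (T b) (N u) =
      -(T (A' a b) + S a (A u b)) + (T (A' b a) + S b (A u a)) := by
    rw [← hg.covAlong_covAlong_sub hs hφ hmaps hu hN,
      covAlong_congr hsu (fun z hz ↦ hA z hz b), covAlong_congr hsu (fun z hz ↦ hA z hz a),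
      covAlong_neg, covAlong_neg]
    simp [dTA]
    abel
  -- the gradient
  have hdf {z : F} (hz : z ∈ s) (b : F) :
      fderiv ℝ (fun z ↦ g (φ z) (W z) (N z)) z b =
      g (φ z) (covAlong g φ W z b) (N z) - g (φ z) (W z) (fderiv ℝ φ z (A z b)) := by
    rw [(hg.hasFDerivAt_inner hs hφ hmaps hz (hW hz).differentiableAt
      (hN' hz).differentiableAt).fderiv]
    simp [hA z hz, sub_eq_add_neg]
  have hWc (b : F) : covAlong g φ W u b = covField g U (φ u) (T b) := by
    rw [covAlong_comp (hφ' hu).differentiableAt (hU' hO).differentiableAt]; rfl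
  -- Differentiate `⟨grad f, b⟩ = ⟨∇̄_b U, N⟩ - ⟨U, A b⟩` along `a`, using metric compatibility on
  -- each inner product.
  have hess (a b : F) := hasFDerivAt_apply_eq_of_eqOn hsu
    (hg.hasFDerivAt_inner hs hφ hmaps hu ((hφ2 hu).clm_apply hGd.hasFDerivAt).differentiableAt
      (diffT b))
    ((hg.hasFDerivAt_inner hs hφ hmaps hu
      (hg.hasFDerivAt_covAlong hs hφ hmaps hu hWs b).differentiableAt
      (hN' hu).differentiableAt).sub (hg.hasFDerivAt_inner hs hφ hmaps hu (hW hu).differentiableAt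
      (diffTA b))) (fun z hz ↦ (hG z hz b).trans (hdf hz b)) a
  -- `Q` is the Christoffel operator of the induced metric in direction `X`, so that `∇_X A = A' X +
  -- QA - AQ`. Subtracting it from `B`, the tangential part of `∇̄U`, puts this correction into the
  -- commutator.
  let Q : F →ₗ[ℝ] F := ((P ∘L S X : F →L[ℝ] F) : F →ₗ[ℝ] F)
  let B : F →ₗ[ℝ] F := ((P ∘L covField g U (φ u) ∘L T : F →L[ℝ] F) : F →ₗ[ℝ] F)
  refine ⟨X, B - Q, LinearMap.ext fun a ↦ hText fun b ↦ ?_⟩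
  rw [hH]
  have hP' (w : E) (c : F) : g (φ u) (T c) (T (P w)) = g (φ u) (T c) w := by
    rw [sy, hP, sy]
  have hAu (a b : F) : g (φ u) (T (A u a)) (T b) = g (φ u) (T (A u b)) (T a) := hAsymm hu a b
  have h0 : covAlong g φ (fun z ↦ covAlong g φ W z b) u a =
      curvature g (φ u) (T a) (U (φ u)) (T b) + covField g U (φ u) (S a b) :=
    hg.covAlong_covAlong_killing hs hφ hmaps hu hU hK a b
  have h1 := hess a b
  simp only [add_apply, sub_apply, ContinuousLinearMap.comp_apply, ContinuousLinearMap.flip_apply,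
    dT, dTA, hWc, hA u hu, ← hT, h0] at h1
  -- the normal and tangential parts of `S a b`
  have h2 := hG u hu (P (S a b))
  rw [hdf hu, hWc, ← hT, hP'] at h2
  -- By skewness `⟨∇̄_N U, N⟩ = 0`, so only the tangential part of `S a b` matters, and this term
  -- cancels against `⟨grad f, S a b⟩`.
  have h4 : g (φ u) (covField g U (φ u) (S a b)) (N u) =
      g (φ u) (covField g U (φ u) (T (P (S a b)))) (N u) := by
    have hskew := hg.apply_covField_skew hK hO (N u) (N u)
    rw [sy (N u)] at hskew
    have h0 : g (φ u) (covField g U (φ u) (N u)) (N u) = 0 := by linarith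
    conv_lhs => rw [hdec (S a b)]
    simp [h0]
  have h5 := hg.apply_curvature_skew hO (T a) (U (φ u)) (T b) (N u)
  have h6 := hA'symm a b X
  have h7 := hg.apply_covField_skew hK hO (T b) (T (A u a))
  have h8 : g (φ u) (T X) (T (A u (P (S a b)))) = g (φ u) (T (A u X)) (S a b) := by
    rw [sy, hAu, sy, hP, sy]
  have h9 : g (φ u) (T (A u b)) (S a X) = g (φ u) (T (A u (P (S X a)))) (T b) := by
    rw [hAu, hP', hSsymm]
  have h10 := hAu (P (covField g U (φ u) (T a))) b
  rw [hP'] at h10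
  have e1 : g (φ u) (T (B (A u a))) (T b) = g (φ u) (covField g U (φ u) (T (A u a))) (T b) := hP _ _
  have e2 : g (φ u) (T (Q (A u a))) (T b) = g (φ u) (S X (A u a)) (T b) := hP _ _
  have e3 := hR a b
  have hWu' : W u = T X + f • N u := hWu
  -- With `U = X + f N`, Codazzi handles the part along `X`; the part along `f N` is the curvature
  -- term of the Jacobi operator.
  have hcurv : curvature g (φ u) (T a) (U (φ u)) (N u) = -(T (A' a X) + S a (A u X)) +
      (T (A' X a) + S X (A u a)) + f • curvature g (φ u) (T a) (N u) (N u) := by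
    rw [hWu, curvature_add_smul, hcod]
  have e4 : g (φ u) (T (A u (B a))) (T b) = g (φ u) (T (A u b)) (covField g U (φ u) (T a)) := h10
  have e5 : g (φ u) (T (A u (Q a))) (T b) = g (φ u) (T (A u b)) (S a X) := h9.symm
  have hAA := hAu (A u a) b
  have hNT (c : F) : g (φ u) (N u) (T c) = 0 := (sy _ _).trans (hTN c)
  have e6 := hII a (A u b)
  rw [hcurv] at h5
  rw [hWu'] at h1 h2
  rw [← sy] at e6
  simp only [map_add, map_sub, map_neg, map_smul, add_apply, sub_apply, smul_apply,
    LinearMap.sub_apply, LinearMap.comp_apply, LinearMap.smul_apply, ContinuousLinearMap.coe_coe,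
    smul_eq_mul, hNT] at h1 h2 h5 h6 ⊢
  rw [e1, e2, e3, e4, e5, hAA, sy _ (T b), sy _ (T b), sy _ (T b), sy _ (T b), sy _ (T b)]
  rw [sy _ (T b), sy _ (T b), sy _ (T X), sy _ (T X)] at h6
  rw [sy (covField g U (φ u) (T a)), sy _ (T b), e6, sy (T (A u a)) (T (A u b))] at h1
  linarith

end IsMetricOn

end LocalHypersurface

/-! ### Metric, vector fields and the Killing equation in a preferred chart -/

section Charts

variable {E : Type*} [NormedAddCommGroup E] [NormedSpace ℝ E]
  {M : Type*} [TopologicalSpace M] [ChartedSpace E M]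

/-- The derivative at `y` of the preferred chart at `x`. -/
def chartD (x y : M) : TangentSpace 𝓘(ℝ, E) y →L[ℝ] E :=
  mvfderiv 𝓘(ℝ, E) (extChartAt 𝓘(ℝ, E) x) y

/-- The derivative at the coordinate point `u` of the inverse of the preferred chart at `x`. -/
def chartSymmD (x : M) (u : E) :
    E →L[ℝ] TangentSpace 𝓘(ℝ, E) ((extChartAt 𝓘(ℝ, E) x).symm u) :=
  mfderiv 𝓘(ℝ, E) 𝓘(ℝ, E) (extChartAt 𝓘(ℝ, E) x).symm u

theorem mlieBracket_vectorSpace (V W : ∀ u : E, TangentSpace 𝓘(ℝ, E) u) (u : E) :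
    VectorField.mlieBracket 𝓘(ℝ, E) V W u =
      fderiv ℝ (W : E → E) u (V u) - fderiv ℝ (V : E → E) u (W u) := by
  have h := congrFun (VectorField.mlieBracketWithin_eq_lieBracketWithin (𝕜 := ℝ) (V := V) (W := W)
    (s := Set.univ)) u
  rw [VectorField.mlieBracketWithin_univ] at h
  exact h.trans (congrFun (VectorField.lieBracketWithin_univ (𝕜 := ℝ) (V := (V : E → E))
    (W := (W : E → E))) u)

variable [IsManifold 𝓘(ℝ, E) ∞ M]

theorem contMDiffAt_chart {x y : M} (hy : y ∈ (extChartAt 𝓘(ℝ, E) x).source) :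
    ContMDiffAt 𝓘(ℝ, E) 𝓘(ℝ, E) ∞ (extChartAt 𝓘(ℝ, E) x) y :=
  contMDiffAt_extChartAt' (by simpa using hy)

theorem contMDiffAt_chart_symm {x : M} {u : E} (hu : u ∈ (extChartAt 𝓘(ℝ, E) x).target) :
    ContMDiffAt 𝓘(ℝ, E) 𝓘(ℝ, E) ∞ (extChartAt 𝓘(ℝ, E) x).symm u :=
  (contMDiffOn_extChartAt_symm x).contMDiffAt ((isOpen_extChartAt_target x).mem_nhds hu)

theorem chartD_chartSymmD {x : M} {u : E} (hu : u ∈ (extChartAt 𝓘(ℝ, E) x).target) (a : E) :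
    chartD x ((extChartAt 𝓘(ℝ, E) x).symm u) (chartSymmD x u a) = a := by
  have := mfderiv_extChartAt_comp_mfderivWithin_extChartAt_symm hu
  simp only [modelWithCornersSelf_coe, Set.range_id, mfderivWithin_univ] at this
  exact DFunLike.congr_fun this a

theorem chartSymmD_chartD {x : M} {u : E} (hu : u ∈ (extChartAt 𝓘(ℝ, E) x).target)
    (v : TangentSpace 𝓘(ℝ, E) ((extChartAt 𝓘(ℝ, E) x).symm u)) :
    chartSymmD x u (chartD x ((extChartAt 𝓘(ℝ, E) x).symm u) v) = v := by
  have := mfderivWithin_extChartAt_symm_comp_mfderiv_extChartAt hu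
  simp only [modelWithCornersSelf_coe, Set.range_id, mfderivWithin_univ] at this
  exact DFunLike.congr_fun this v

/-- At the base point the coordinate expression of a vector is the vector itself, so coordinate
identities there are already invariant ones. -/
theorem chartD_self (x : M) (v : TangentSpace 𝓘(ℝ, E) x) : chartD x x v = v :=
  DFunLike.congr_fun (mfderiv_extChartAt_self (I := 𝓘(ℝ, E)) (x := x)) v

theorem trivializationAt_snd {x y : M} (hy : y ∈ (extChartAt 𝓘(ℝ, E) x).source)
    (v : TangentSpace 𝓘(ℝ, E) y) :
    (trivializationAt E (TangentSpace 𝓘(ℝ, E) : M → Type _) x ⟨y, v⟩).2 = chartD x y v := by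
  have hy : y ∈ (chartAt E x).source := by simpa using hy
  have := TangentBundle.continuousLinearMapAt_trivializationAt (I := 𝓘(ℝ, E)) hy
  have h2 := DFunLike.congr_fun this v
  rw [Bundle.Trivialization.continuousLinearMapAt_apply,
    Bundle.Trivialization.coe_linearMapAt_of_mem _ (by simpa using hy)] at h2
  exact h2

theorem symmL_eq_chartSymmD {x : M} {u : E} (hu : u ∈ (extChartAt 𝓘(ℝ, E) x).target) (a : E) :
    (trivializationAt E (TangentSpace 𝓘(ℝ, E) : M → Type _) x).symmL ℝ
      ((extChartAt 𝓘(ℝ, E) x).symm u) a = chartSymmD x u a := by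
  have hy : (extChartAt 𝓘(ℝ, E) x).symm u ∈ (chartAt E x).source := by
    simpa using (extChartAt 𝓘(ℝ, E) x).map_target hu
  have := TangentBundle.symmL_trivializationAt (I := 𝓘(ℝ, E)) hy
  rw [(extChartAt 𝓘(ℝ, E) x).right_inv hu] at this
  simp only [modelWithCornersSelf_coe, Set.range_id, mfderivWithin_univ] at this
  exact DFunLike.congr_fun this a

/-- In the trivialization at `x` the coordinate field has constant component `a`. Smoothness of the
metric coefficients follows. -/
theorem contMDiffAt_chartSymmD {x : M} {u : E} (hu : u ∈ (extChartAt 𝓘(ℝ, E) x).target) (a : E) :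
    ContMDiffAt 𝓘(ℝ, E) 𝓘(ℝ, E).tangent ∞ (fun u ↦
      (⟨(extChartAt 𝓘(ℝ, E) x).symm u, chartSymmD x u a⟩ : TangentBundle 𝓘(ℝ, E) M)) u := by
  refine ((trivializationAt E (TangentSpace 𝓘(ℝ, E) : M → Type _) x).contMDiffAt_iff ?_).2 ⟨?_, ?_⟩
  · simpa [Bundle.Trivialization.mem_source] using (extChartAt 𝓘(ℝ, E) x).map_target hu
  · exact contMDiffAt_chart_symm hu
  · refine (contMDiffAt_const (c := a)).congr_of_eventuallyEq ?_
    filter_upwards [(isOpen_extChartAt_target x).mem_nhds hu] with z hz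
    rw [trivializationAt_snd ((extChartAt 𝓘(ℝ, E) x).map_target hz), chartD_chartSymmD hz]

section Metric

variable [RiemannianBundle (fun x : M ↦ TangentSpace 𝓘(ℝ, E) x)]

theorem metricInChart_apply {x : M} {u : E} (hu : u ∈ (extChartAt 𝓘(ℝ, E) x).target) (a b : E) :
    metricInChart x u a b = inner ℝ (chartSymmD x u a) (chartSymmD x u b) := by
  rw [← symmL_eq_chartSymmD hu, ← symmL_eq_chartSymmD hu]
  rfl

theorem metricInChart_chartD {x : M} {u : E} (hu : u ∈ (extChartAt 𝓘(ℝ, E) x).target)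
    (v w : TangentSpace 𝓘(ℝ, E) ((extChartAt 𝓘(ℝ, E) x).symm u)) :
    metricInChart x u (chartD x _ v) (chartD x _ w) = inner ℝ v w := by
  rw [metricInChart_apply hu, chartSymmD_chartD hu, chartSymmD_chartD hu]

variable [FiniteDimensional ℝ E]
  [IsContMDiffRiemannianBundle 𝓘(ℝ, E) ∞ E (fun x : M ↦ TangentSpace 𝓘(ℝ, E) x)]

theorem isMetricOn_metricInChart (x : M) :
    IsMetricOn (metricInChart (E := E) x) (extChartAt 𝓘(ℝ, E) x).target where
  isOpen := isOpen_extChartAt_target x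
  contDiffOn := by
    refine contDiffOn_clm_apply.2 fun a ↦ contDiffOn_clm_apply.2 fun b ↦ ?_
    refine ContDiffOn.congr ?_ fun u hu ↦ metricInChart_apply hu a b
    intro u hu
    have h := ContMDiffAt.inner_bundle (F := E) (E := fun x : M ↦ TangentSpace 𝓘(ℝ, E) x)
      (contMDiffAt_chartSymmD hu a) (contMDiffAt_chartSymmD hu b)
    exact h.contDiffAt.contDiffWithinAt
  symm u hu a b := by
    rw [metricInChart_apply hu, metricInChart_apply hu, real_inner_comm]
  pos u hu a ha := by
    rw [metricInChart_apply hu, real_inner_self_eq_norm_sq]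
    refine pow_pos (norm_pos_iff.2 fun h ↦ ha ?_) 2
    rw [← chartD_chartSymmD hu a, h, map_zero]

end Metric

/-- A vector field read in the preferred chart at `x`. -/
def fieldInChart (x : M) (U : ∀ y : M, TangentSpace 𝓘(ℝ, E) y) (u : E) : E :=
  chartD x _ (U ((extChartAt 𝓘(ℝ, E) x).symm u))

theorem chartSymmD_fieldInChart {x : M} {U : ∀ y : M, TangentSpace 𝓘(ℝ, E) y} {u : E}
    (hu : u ∈ (extChartAt 𝓘(ℝ, E) x).target) :
    chartSymmD x u (fieldInChart x U u) = U ((extChartAt 𝓘(ℝ, E) x).symm u) :=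
  chartSymmD_chartD hu _

theorem inverse_mfderiv_chart_symm {x : M} {u : E} (hu : u ∈ (extChartAt 𝓘(ℝ, E) x).target) :
    (mfderiv 𝓘(ℝ, E) 𝓘(ℝ, E) (extChartAt 𝓘(ℝ, E) x).symm u).inverse =
      mfderiv 𝓘(ℝ, E) 𝓘(ℝ, E) (extChartAt 𝓘(ℝ, E) x) ((extChartAt 𝓘(ℝ, E) x).symm u) :=
  ContinuousLinearMap.inverse_eq (ContinuousLinearMap.ext fun v ↦ chartSymmD_chartD hu v)
    (ContinuousLinearMap.ext fun a ↦ chartD_chartSymmD hu a)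

theorem mvfderiv_chartSymmD {V : Type*} [NormedAddCommGroup V] [NormedSpace ℝ V] {f : M → V}
    {x : M} {u : E} (hu : u ∈ (extChartAt 𝓘(ℝ, E) x).target)
    (hf : MDifferentiableAt 𝓘(ℝ, E) 𝓘(ℝ, V) f ((extChartAt 𝓘(ℝ, E) x).symm u)) (a : E) :
    mvfderiv 𝓘(ℝ, E) f ((extChartAt 𝓘(ℝ, E) x).symm u) (chartSymmD x u a) =
      fderiv ℝ (f ∘ (extChartAt 𝓘(ℝ, E) x).symm) u a := by
  have := mfderiv_comp u hf ((contMDiffAt_chart_symm hu).mdifferentiableAt (by simp))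
  rw [mfderiv_eq_fderiv] at this
  exact (DFunLike.congr_fun this a).symm

theorem contDiffOn_fieldInChart {x : M} {U : ∀ y : M, TangentSpace 𝓘(ℝ, E) y}
    (hU : ContMDiff 𝓘(ℝ, E) 𝓘(ℝ, E).tangent ∞
      (fun x ↦ (⟨x, U x⟩ : TangentBundle 𝓘(ℝ, E) M))) :
    ContDiffOn ℝ ∞ (fieldInChart x U) (extChartAt 𝓘(ℝ, E) x).target := by
  intro u hu
  have h := ((hU _).comp u (contMDiffAt_chart_symm hu))
  have h2 := (((trivializationAt E (TangentSpace 𝓘(ℝ, E) : M → Type _) x).contMDiffAt_iff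
    (by simpa [Bundle.Trivialization.mem_source] using (extChartAt 𝓘(ℝ, E) x).map_target hu)).1
      h).2
  refine (h2.congr_of_eventuallyEq ?_).contDiffAt.contDiffWithinAt
  filter_upwards [(isOpen_extChartAt_target x).mem_nhds hu] with z hz
  exact (trivializationAt_snd ((extChartAt 𝓘(ℝ, E) x).map_target hz) _).symm

/-- The Killing equation in the preferred chart at `x`. -/
theorem IsKillingField.chart_equation [FiniteDimensional ℝ E]
    [RiemannianBundle (fun x : M ↦ TangentSpace 𝓘(ℝ, E) x)]
    [IsContMDiffRiemannianBundle 𝓘(ℝ, E) ∞ E (fun x : M ↦ TangentSpace 𝓘(ℝ, E) x)]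
    {U : ∀ x : M, TangentSpace 𝓘(ℝ, E) x} (hU : IsKillingField U) (x : M) {u : E}
    (hu : u ∈ (extChartAt 𝓘(ℝ, E) x).target) (a b : E) :
    fderiv ℝ (metricInChart x) u (fieldInChart x U u) a b
      + metricInChart x u (fderiv ℝ (fieldInChart x U) u a) b
      + metricInChart x u a (fderiv ℝ (fieldInChart x U) u b) = 0 := by
  set ψ := (extChartAt 𝓘(ℝ, E) x).symm with hψ
  have hy := (extChartAt 𝓘(ℝ, E) x).map_target hu
  have hnhds := (isOpen_extChartAt_target (I := 𝓘(ℝ, E)) x).mem_nhds hu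
  -- The Killing condition is tested on the coordinate fields of the chart, extended to all of `M`
  -- through the trivialization; only their smoothness at the point matters.
  let X (c : E) (y : M) : TangentSpace 𝓘(ℝ, E) y :=
    (trivializationAt E (TangentSpace 𝓘(ℝ, E) : M → Type _) x).symmL ℝ y c
  have hX (c : E) {z : E} (hz : z ∈ (extChartAt 𝓘(ℝ, E) x).target) : X c (ψ z) = chartSymmD x z c :=
    symmL_eq_chartSymmD hz c
  have hXs (c : E) : ContMDiffAt 𝓘(ℝ, E) 𝓘(ℝ, E).tangent ∞
      (fun y ↦ (⟨y, X c y⟩ : TangentBundle 𝓘(ℝ, E) M)) (ψ u) := by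
    refine ((trivializationAt E (TangentSpace 𝓘(ℝ, E) : M → Type _) x).contMDiffAt_iff ?_).2
      ⟨contMDiffAt_id, (contMDiffAt_const (c := c)).congr_of_eventuallyEq ?_⟩
    · exact (Bundle.Trivialization.mem_source _).2 (by simpa [hψ] using hy)
    · filter_upwards [(isOpen_extChartAt_source (I := 𝓘(ℝ, E)) x).mem_nhds hy] with y hy
      obtain ⟨z, hz, rfl⟩ : ∃ z ∈ (extChartAt 𝓘(ℝ, E) x).target, ψ z = y :=
        ⟨_, (extChartAt 𝓘(ℝ, E) x).map_source hy, (extChartAt 𝓘(ℝ, E) x).left_inv hy⟩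
      rw [hX c hz, trivializationAt_snd hy, chartD_chartSymmD hz]
  have hXd (c : E) := (hXs c).mdifferentiableAt (by simp)
  have : IsManifold 𝓘(ℝ, E) (minSmoothness ℝ 2) M :=
    IsManifold.of_le (n := ∞) (by simpa using ENat.LEInfty.out)
  -- Pulled back to the chart, `X c` is constant, so only the derivative of `U` survives in the
  -- bracket, with a minus sign.
  have hbr (c : E) : VectorField.mlieBracket 𝓘(ℝ, E) U (X c) (ψ u) =
      -chartSymmD x u (fderiv ℝ (fieldInChart x U) u c) := by
    have h1 := VectorField.mpullback_mlieBracket (n := ∞) (f := ψ) (x₀ := u)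
      ((hU.contMDiff _).mdifferentiableAt (by simp)) (hXd c) (contMDiffAt_chart_symm hu)
      (by simpa using ENat.LEInfty.out)
    have hUp : VectorField.mpullback 𝓘(ℝ, E) 𝓘(ℝ, E) ψ U =ᶠ[nhds u] fieldInChart x U := by
      filter_upwards [hnhds] with z hz
      rw [VectorField.mpullback_apply]
      exact DFunLike.congr_fun (inverse_mfderiv_chart_symm hz) _
    have hXp : VectorField.mpullback 𝓘(ℝ, E) 𝓘(ℝ, E) ψ (X c) =ᶠ[nhds u] fun _ ↦ c := by
      filter_upwards [hnhds] with z hz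
      rw [VectorField.mpullback_apply, hX c hz]
      exact (DFunLike.congr_fun (inverse_mfderiv_chart_symm hz) _).trans (chartD_chartSymmD hz c)
    rw [hUp.mlieBracket_vectorField_eq hXp, VectorField.mpullback_apply] at h1
    have h2 : chartD x (ψ u) (VectorField.mlieBracket 𝓘(ℝ, E) U (X c) (ψ u)) =
        -fderiv ℝ (fieldInChart x U) u c := by
      refine (DFunLike.congr_fun (inverse_mfderiv_chart_symm hu) _).symm.trans (h1.trans ?_)
      refine (mlieBracket_vectorSpace (fieldInChart x U) (fun _ ↦ c) u).trans ?_
      simp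
      rfl
    rw [← map_neg, ← h2, chartSymmD_chartD hu]
  have hF : MDifferentiableAt 𝓘(ℝ, E) 𝓘(ℝ, ℝ) (fun y ↦ inner ℝ (X a y) (X b y)) (ψ u) := by
    have h := ContMDiffAt.inner_bundle (F := E) (E := fun x : M ↦ TangentSpace 𝓘(ℝ, E) x)
      (hXs a) (hXs b)
    exact h.mdifferentiableAt (by simp)
  have key := hU.lieDerivative_metric (ψ u) (X a) (X b) (hXd a) (hXd b)
  rw [hbr, hbr, hX a hu, hX b hu, ← chartSymmD_fieldInChart (U := U) hu, mvfderiv_chartSymmD hu hF,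
    inner_neg_left, inner_neg_right, ← metricInChart_apply hu, ← metricInChart_apply hu] at key
  have hE : (fun y ↦ inner ℝ (X a y) (X b y)) ∘ ψ =ᶠ[nhds u] fun z ↦ metricInChart x z a b := by
    filter_upwards [hnhds] with z hz
    rw [Function.comp_apply, hX a hz, hX b hz, metricInChart_apply hz]
  have hder := (((isMetricOn_metricInChart (E := E) x).differentiableAt hu).hasFDerivAt.clm_apply
    (hasFDerivAt_const a u)).clm_apply (hasFDerivAt_const b u)
  rw [hE.fderiv_eq, hder.fderiv] at key
  simp at key
  linarith

end Charts

/-! ### Shape operator, gradient and Jacobi equation in coordinates -/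

section LocalShape

variable {E : Type*} [NormedAddCommGroup E] [NormedSpace ℝ E]
  {F : Type*} [NormedAddCommGroup F] [NormedSpace ℝ F]

/-- The metric induced by a map between vector spaces. -/
def inducedMetric (g : E → E →L[ℝ] E →L[ℝ] ℝ) (φ : F → E) (u : F) : F →L[ℝ] F →L[ℝ] ℝ :=
  (ContinuousLinearMap.compL ℝ F E ℝ).flip (fderiv ℝ φ u) ∘L g (φ u) ∘L fderiv ℝ φ u

/-- The tangential projection along a map between vector spaces. -/
def tangentialProj (g : E → E →L[ℝ] E →L[ℝ] ℝ) (φ : F → E) (u : F) : E →L[ℝ] F :=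
  (inducedMetric g φ u).inverse ∘L
    (ContinuousLinearMap.compL ℝ F E ℝ).flip (fderiv ℝ φ u) ∘L g (φ u)

/-- The shape operator along a map between vector spaces. -/
def localShape (g : E → E →L[ℝ] E →L[ℝ] ℝ) (φ N : F → E) (u : F) : F →L[ℝ] F :=
  -(tangentialProj g φ u ∘L covAlong g φ N u)

/-- The gradient of a function for the metric induced by a map between vector spaces. -/
def localGrad (g : E → E →L[ℝ] E →L[ℝ] ℝ) (φ : F → E) (f : F → ℝ) (u : F) : F :=
  (inducedMetric g φ u).inverse (fderiv ℝ f u)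

/-- A hypersurface in coordinates with its unit normal field. -/
structure IsHypersurfaceOn (g : E → E →L[ℝ] E →L[ℝ] ℝ) (O : Set E) (φ N : F → E) (s : Set F) :
    Prop where
  metric : IsMetricOn g O
  isOpen : IsOpen s
  contDiffOn : ContDiffOn ℝ ∞ φ s
  mapsTo : Set.MapsTo φ s O
  injective : ∀ u ∈ s, Function.Injective (fderiv ℝ φ u)
  contDiffOn_normal : ContDiffOn ℝ ∞ N s
  normal_unit : ∀ u ∈ s, g (φ u) (N u) (N u) = 1
  normal_orthogonal : ∀ u ∈ s, ∀ a, g (φ u) (fderiv ℝ φ u a) (N u) = 0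
  codim : Module.finrank ℝ E = Module.finrank ℝ F + 1

namespace IsHypersurfaceOn

variable {g : E → E →L[ℝ] E →L[ℝ] ℝ} {O : Set E} {s : Set F} {φ N : F → E} {u : F}
  (h : IsHypersurfaceOn g O φ N s)
include h

theorem contDiffOn_fderiv : ContDiffOn ℝ ∞ (fderiv ℝ φ) s :=
  h.contDiffOn.fderiv_of_isOpen h.isOpen (by simp)

theorem contDiffOn_metric : ContDiffOn ℝ ∞ (fun u ↦ g (φ u)) s :=
  h.metric.contDiffOn.comp h.contDiffOn h.mapsTo

theorem inducedMetric_isInvertible [FiniteDimensional ℝ F] (hu : u ∈ s) :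
    (inducedMetric g φ u).IsInvertible := by
  refine isInvertible_of_pos fun a ha ↦ h.metric.pos _ (h.mapsTo hu) _ fun h0 ↦ ha ?_
  exact h.injective u hu (by simpa using h0)

theorem apply_tangentialProj [FiniteDimensional ℝ F] (hu : u ∈ s) (w : E) (c : F) :
    g (φ u) (fderiv ℝ φ u (tangentialProj g φ u w)) (fderiv ℝ φ u c) =
      g (φ u) w (fderiv ℝ φ u c) :=
  DFunLike.congr_fun (apply_inverse_of_isInvertible (h.inducedMetric_isInvertible hu)
    ((ContinuousLinearMap.compL ℝ F E ℝ).flip (fderiv ℝ φ u) (g (φ u) w))) c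

theorem apply_localGrad [FiniteDimensional ℝ F] (hu : u ∈ s) (f : F → ℝ) (c : F) :
    g (φ u) (fderiv ℝ φ u (localGrad g φ f u)) (fderiv ℝ φ u c) = fderiv ℝ f u c :=
  DFunLike.congr_fun (apply_inverse_of_isInvertible (h.inducedMetric_isInvertible hu)
    (fderiv ℝ f u)) c

theorem contDiffOn_inducedMetric_inverse [FiniteDimensional ℝ F] :
    ContDiffOn ℝ ∞ (fun u ↦ (inducedMetric g φ u).inverse) s := by
  refine contDiffOn_inverse ?_ fun u hu ↦ h.inducedMetric_isInvertible hu
  exact ((ContinuousLinearMap.contDiff _).comp_contDiffOn h.contDiffOn_fderiv).clm_comp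
    (h.contDiffOn_metric.clm_comp h.contDiffOn_fderiv)

theorem contDiffOn_covAlong [FiniteDimensional ℝ E] : ContDiffOn ℝ ∞ (covAlong g φ N) s := by
  have h1 : ContDiffOn ℝ ∞ (fderiv ℝ N) s :=
    h.contDiffOn_normal.fderiv_of_isOpen h.isOpen (by simp)
  have h2 : ContDiffOn ℝ ∞ (fun u ↦ (christoffel g (φ u)).flip) s :=
    (ContinuousLinearMap.flipₗᵢ ℝ E E E).contDiff.comp_contDiffOn
      (h.metric.contDiffOn_christoffel.comp h.contDiffOn h.mapsTo)
  exact h1.add ((h2.clm_apply h.contDiffOn_normal).clm_comp h.contDiffOn_fderiv)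

theorem contDiffOn_localGrad [FiniteDimensional ℝ F] {f : F → ℝ} (hf : ContDiffOn ℝ ∞ f s) :
    ContDiffOn ℝ ∞ (localGrad g φ f) s :=
  h.contDiffOn_inducedMetric_inverse.clm_apply (hf.fderiv_of_isOpen h.isOpen (by simp))

variable [FiniteDimensional ℝ E] [FiniteDimensional ℝ F]

/-- The map `(v, t) ↦ dφ v + t N` is injective by orthogonality, hence surjective by equality of
dimensions: this is where codimension one enters. -/
theorem exists_decomposition (hu : u ∈ s) (w : E) :
    ∃ v : F, ∃ t : ℝ, w = fderiv ℝ φ u v + t • N u := by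
  let T : F × ℝ →ₗ[ℝ] E := (fderiv ℝ φ u).toLinearMap.coprod (LinearMap.toSpanSingleton ℝ E (N u))
  have hT : Function.Injective T := by
    rw [injective_iff_map_eq_zero]
    rintro ⟨v, t⟩ hvt
    have hvt : fderiv ℝ φ u v + t • N u = 0 := by simpa [T] using hvt
    have ht : t = 0 := by
      have := congrArg (fun w ↦ g (φ u) w (N u)) hvt
      simpa [h.normal_orthogonal u hu, h.normal_unit u hu] using this
    subst ht
    have hv : v = 0 := h.injective u hu (by simpa using hvt)
    rw [hv]; rfl
  obtain ⟨⟨v, t⟩, hvt⟩ := (LinearMap.injective_iff_surjective_of_finrank_eq_finrank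
    (by simp [h.codim])).1 hT w
  exact ⟨v, t, by simpa [T] using hvt.symm⟩

theorem ext_tangent (hu : u ∈ s) {x y : F} (hxy : ∀ c, g (φ u) (fderiv ℝ φ u x) (fderiv ℝ φ u c) =
    g (φ u) (fderiv ℝ φ u y) (fderiv ℝ φ u c)) : x = y := by
  refine h.injective u hu (h.metric.ext_left (h.mapsTo hu) fun c ↦ ?_)
  obtain ⟨c, t, rfl⟩ := h.exists_decomposition hu c
  rw [map_add, map_add, map_smul, map_smul, h.normal_orthogonal u hu, h.normal_orthogonal u hu, hxy]

theorem contDiffOn_localShape : ContDiffOn ℝ ∞ (localShape g φ N) s :=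
  ((h.contDiffOn_inducedMetric_inverse.clm_comp
    (((ContinuousLinearMap.contDiff _).comp_contDiffOn h.contDiffOn_fderiv).clm_comp
      h.contDiffOn_metric)).clm_comp h.contDiffOn_covAlong).neg

/-- The Weingarten equation. -/
theorem covAlong_normal (hu : u ∈ s) (a : F) :
    covAlong g φ N u a = -fderiv ℝ φ u (localShape g φ N u a) := by
  have hO := h.mapsTo hu
  have hN := (hasFDerivAt_of_contDiffOn h.isOpen h.contDiffOn_normal hu).differentiableAt
  -- Differentiating `⟨N, N⟩ = 1` shows that the derivative of `N` has no normal component.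
  have h1 := hasFDerivAt_apply_eq_of_eqOn (h.isOpen.mem_nhds hu)
    (h.metric.hasFDerivAt_inner h.isOpen h.contDiffOn h.mapsTo hu hN hN) (hasFDerivAt_const 1 u)
    (fun z hz ↦ h.normal_unit z hz) a
  simp only [add_apply, ContinuousLinearMap.comp_apply, ContinuousLinearMap.flip_apply, zero_apply,
    h.metric.symm _ hO (N u)] at h1
  refine h.metric.ext_left hO fun c ↦ ?_
  obtain ⟨c, t, rfl⟩ := h.exists_decomposition hu c
  have h2 := h.apply_tangentialProj hu (covAlong g φ N u a) c
  have h3 := h.normal_orthogonal u hu (localShape g φ N u a)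
  simp only [localShape, neg_apply, map_neg, ContinuousLinearMap.comp_apply, neg_neg, map_add,
    map_smul, neg_eq_zero, smul_eq_mul] at h3 ⊢
  rw [h2, h3, show g (φ u) (covAlong g φ N u a) (N u) = 0 by linarith]

/-- Differentiating `⟨dφ b, N⟩ = 0` gives `⟨A a, b⟩ = ⟨II(a, b), N⟩`, and the second fundamental
form is symmetric. -/
theorem localShape_symm (hu : u ∈ s) (a b : F) :
    g (φ u) (fderiv ℝ φ u (localShape g φ N u a)) (fderiv ℝ φ u b) =
      g (φ u) (fderiv ℝ φ u a) (fderiv ℝ φ u (localShape g φ N u b)) := by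
  have key (a b : F) : g (φ u) (secondForm g φ u a b) (N u) =
      g (φ u) (fderiv ℝ φ u (localShape g φ N u a)) (fderiv ℝ φ u b) := by
    have := hasFDerivAt_apply_eq_of_eqOn (h.isOpen.mem_nhds hu)
      (h.metric.hasFDerivAt_inner h.isOpen h.contDiffOn h.mapsTo hu
        ((hasFDerivAt_fderiv_of_contDiffOn h.isOpen h.contDiffOn hu).clm_apply
          (hasFDerivAt_const b u)).differentiableAt
        (hasFDerivAt_of_contDiffOn h.isOpen h.contDiffOn_normal hu).differentiableAt)
      (hasFDerivAt_const 0 u) (fun z hz ↦ h.normal_orthogonal z hz b) a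
    simp [covAlong_fderiv h.isOpen h.contDiffOn hu (hasFDerivAt_const b u),
      h.covAlong_normal hu] at this
    rw [h.metric.symm _ (h.mapsTo hu) (fderiv ℝ φ u (localShape g φ N u a))]
    linarith
  rw [h.metric.symm _ (h.mapsTo hu) (fderiv ℝ φ u a), ← key, ← key,
    h.metric.secondForm_symm h.isOpen h.contDiffOn h.mapsTo hu]

/-- The Jacobi equation for the support function of a Killing field, in coordinates. -/
theorem jacobi_equation {U : E → E} (hU : ContDiffOn ℝ ∞ U O)
    (hK : ∀ y ∈ O, ∀ a b, fderiv ℝ g y (U y) a b + g y (fderiv ℝ U y a) b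
      + g y a (fderiv ℝ U y b) = 0) {r : ℕ} {c : ℝ}
    (hsplit : ∀ z ∈ s, (localShape g φ N z : F →ₗ[ℝ] F).charpoly.Splits)
    (hconst : ∀ z ∈ s, esymmEigenvalues (localShape g φ N z : F →ₗ[ℝ] F) (r + 1) = c)
    (hu : u ∈ s) {f : F → ℝ} (hf : ∀ z ∈ s, f z = g (φ z) (U (φ z)) (N z))
    {A H R : F →ₗ[ℝ] F} (hA : A = localShape g φ N u)
    (hH : ∀ a, H a = tangentialProj g φ u
      (covAlong g φ (fun z ↦ fderiv ℝ φ z (localGrad g φ f z)) u a))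
    (hR : ∀ a, R a = tangentialProj g φ u (curvature g (φ u) (fderiv ℝ φ u a) (N u) (N u))) :
    LinearMap.trace ℝ F (newtonTransform A r ∘ₗ H)
      + LinearMap.trace ℝ F (A ∘ₗ A ∘ₗ newtonTransform A r) * f u
      + LinearMap.trace ℝ F (R ∘ₗ newtonTransform A r) * f u = 0 := by
  subst hA
  have hfs : ContDiffOn ℝ ∞ f s := by
    refine ContDiffOn.congr ?_ hf
    exact (h.contDiffOn_metric.clm_apply (hU.comp h.contDiffOn h.mapsTo)).clm_apply
      h.contDiffOn_normal
  have hsu := h.isOpen.mem_nhds hu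
  have hA' := hasFDerivAt_of_contDiffOn h.isOpen h.contDiffOn_localShape hu
  obtain ⟨X, B, hB⟩ := h.metric.hessian_support_function h.isOpen h.contDiffOn h.mapsTo hu hU hK
    h.contDiffOn_normal (h.normal_unit u hu) h.normal_orthogonal (h.injective u hu)
    (h.exists_decomposition hu) hA' (fun z hz ↦ h.covAlong_normal hz)
    (hasFDerivAt_of_contDiffOn h.isOpen (h.contDiffOn_localGrad hfs) hu).differentiableAt
    (H := H) (R := R) (fun z hz b ↦ by
      rw [h.apply_localGrad hz]
      congr 1
      refine Filter.EventuallyEq.fderiv_eq ?_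
      filter_upwards [h.isOpen.mem_nhds hz] with w hw using hf w hw)
    (fun a b ↦ by rw [hH, h.apply_tangentialProj hu])
    (fun a b ↦ by rw [hR, h.apply_tangentialProj hu])
  -- Constancy of `S_{r+1}` is used here, in the direction of the tangential part of `U`.
  have h0 := trace_newtonTransform_comp_eq_zero hA' hsu hsplit hconst X
  have h1 := trace_newtonTransform_commutator (A := (localShape g φ N u : F →ₗ[ℝ] F)) r B
  rw [hB, hf u hu]
  simp only [LinearMap.comp_sub, map_sub, LinearMap.comp_smul, map_smul, smul_eq_mul] at h1 ⊢
  rw [h1, h0, LinearMap.trace_comp_comm' _ R,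
    LinearMap.trace_comp_comm' (_ ∘ₗ _) (newtonTransform _ r), LinearMap.comp_assoc]
  ring

end IsHypersurfaceOn

end LocalShape

/-! ### Change of charts and the transformation of Christoffel symbols -/

section ChartChange

variable {E : Type*} [NormedAddCommGroup E] [NormedSpace ℝ E]
  {M : Type*} [TopologicalSpace M] [ChartedSpace E M]

/-- The transition map from the preferred chart at `x` to the preferred chart at `x'`. -/
def transition (x x' : M) : E → E := extChartAt 𝓘(ℝ, E) x' ∘ (extChartAt 𝓘(ℝ, E) x).symm

/-- The domain of the transition map. -/
def transitionDomain (x x' : M) : Set E :=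
  (extChartAt 𝓘(ℝ, E) x).target ∩ (extChartAt 𝓘(ℝ, E) x).symm ⁻¹' (extChartAt 𝓘(ℝ, E) x').source

theorem isOpen_transitionDomain (x x' : M) : IsOpen (transitionDomain (E := E) x x') :=
  (continuousOn_extChartAt_symm x).isOpen_inter_preimage (isOpen_extChartAt_target x)
    (isOpen_extChartAt_source x')

variable [IsManifold 𝓘(ℝ, E) ∞ M]

theorem chartD_injective {x y : M} (hy : y ∈ (extChartAt 𝓘(ℝ, E) x).source) :
    Function.Injective (chartD (E := E) x y) := by
  obtain ⟨u, hu, rfl⟩ : ∃ u ∈ (extChartAt 𝓘(ℝ, E) x).target, (extChartAt 𝓘(ℝ, E) x).symm u = y :=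
    ⟨_, (extChartAt 𝓘(ℝ, E) x).map_source hy, (extChartAt 𝓘(ℝ, E) x).left_inv hy⟩
  intro v w hvw
  rw [← chartSymmD_chartD hu v, hvw, chartSymmD_chartD hu]

theorem chartD_surjective {x y : M} (hy : y ∈ (extChartAt 𝓘(ℝ, E) x).source) :
    Function.Surjective (chartD (E := E) x y) := by
  obtain ⟨u, hu, rfl⟩ : ∃ u ∈ (extChartAt 𝓘(ℝ, E) x).target, (extChartAt 𝓘(ℝ, E) x).symm u = y :=
    ⟨_, (extChartAt 𝓘(ℝ, E) x).map_source hy, (extChartAt 𝓘(ℝ, E) x).left_inv hy⟩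
  exact fun a ↦ ⟨_, chartD_chartSymmD hu a⟩

theorem mdifferentiableAt_of_comp_chart_symm {V : Type*} [NormedAddCommGroup V] [NormedSpace ℝ V]
    {f : M → V} {x y : M} (hy : y ∈ (extChartAt 𝓘(ℝ, E) x).source)
    (hf : DifferentiableAt ℝ (f ∘ (extChartAt 𝓘(ℝ, E) x).symm) (extChartAt 𝓘(ℝ, E) x y)) :
    MDifferentiableAt 𝓘(ℝ, E) 𝓘(ℝ, V) f y := by
  refine (hf.mdifferentiableAt.comp y
    ((contMDiffAt_chart hy).mdifferentiableAt (by simp))).congr_of_eventuallyEq ?_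
  filter_upwards [(isOpen_extChartAt_source (I := 𝓘(ℝ, E)) x).mem_nhds hy] with z hz
  exact congrArg f ((extChartAt 𝓘(ℝ, E) x).left_inv hz).symm

theorem mvfderiv_eq_fderiv_chart {V : Type*} [NormedAddCommGroup V] [NormedSpace ℝ V]
    {f : M → V} {x y : M} (hy : y ∈ (extChartAt 𝓘(ℝ, E) x).source)
    (hf : MDifferentiableAt 𝓘(ℝ, E) 𝓘(ℝ, V) f y) (v : TangentSpace 𝓘(ℝ, E) y) :
    mvfderiv 𝓘(ℝ, E) f y v =
      fderiv ℝ (f ∘ (extChartAt 𝓘(ℝ, E) x).symm) (extChartAt 𝓘(ℝ, E) x y) (chartD x y v) := by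
  obtain ⟨u, hu, rfl⟩ : ∃ u ∈ (extChartAt 𝓘(ℝ, E) x).target, (extChartAt 𝓘(ℝ, E) x).symm u = y :=
    ⟨_, (extChartAt 𝓘(ℝ, E) x).map_source hy, (extChartAt 𝓘(ℝ, E) x).left_inv hy⟩
  rw [(extChartAt 𝓘(ℝ, E) x).right_inv hu, ← mvfderiv_chartSymmD hu hf, chartSymmD_chartD hu]

theorem contDiffOn_transition (x x' : M) :
    ContDiffOn ℝ ∞ (transition (E := E) x x') (transitionDomain x x') := fun _ hu ↦
  ((contMDiffAt_chart hu.2).comp _ (contMDiffAt_chart_symm hu.1)).contDiffAt.contDiffWithinAt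

theorem fderiv_transition {x x' y : M} (hy : y ∈ (extChartAt 𝓘(ℝ, E) x).source)
    (hy' : y ∈ (extChartAt 𝓘(ℝ, E) x').source) (v : TangentSpace 𝓘(ℝ, E) y) :
    fderiv ℝ (transition (E := E) x x') (extChartAt 𝓘(ℝ, E) x y) (chartD x y v) = chartD x' y v :=
  (mvfderiv_eq_fderiv_chart hy ((contMDiffAt_chart hy').mdifferentiableAt (by simp)) v).symm

theorem fderiv_transition_bijective {x x' y : M} (hy : y ∈ (extChartAt 𝓘(ℝ, E) x).source)
    (hy' : y ∈ (extChartAt 𝓘(ℝ, E) x').source) :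
    Function.Bijective (fderiv ℝ (transition (E := E) x x') (extChartAt 𝓘(ℝ, E) x y)) := by
  constructor
  · intro a b hab
    obtain ⟨v, rfl⟩ := chartD_surjective hy a
    obtain ⟨w, rfl⟩ := chartD_surjective hy b
    rw [fderiv_transition hy hy', fderiv_transition hy hy'] at hab
    rw [chartD_injective hy' hab]
  · intro a
    obtain ⟨v, rfl⟩ := chartD_surjective hy' a
    exact ⟨_, fderiv_transition hy hy' v⟩

theorem IsMetricOn.mono {g : E → E →L[ℝ] E →L[ℝ] ℝ} {O O' : Set E} (hg : IsMetricOn g O)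
    (hO' : IsOpen O') (h : O' ⊆ O) : IsMetricOn g O' where
  isOpen := hO'
  contDiffOn := hg.contDiffOn.mono h
  symm y hy := hg.symm y (h hy)
  pos y hy := hg.pos y (h hy)

variable [RiemannianBundle (fun x : M ↦ TangentSpace 𝓘(ℝ, E) x)]

theorem metricInChart_extChartAt {x y : M} (hy : y ∈ (extChartAt 𝓘(ℝ, E) x).source)
    (v w : TangentSpace 𝓘(ℝ, E) y) :
    metricInChart x (extChartAt 𝓘(ℝ, E) x y) (chartD x y v) (chartD x y w) = inner ℝ v w := by
  obtain ⟨u, hu, rfl⟩ : ∃ u ∈ (extChartAt 𝓘(ℝ, E) x).target, (extChartAt 𝓘(ℝ, E) x).symm u = y :=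
    ⟨_, (extChartAt 𝓘(ℝ, E) x).map_source hy, (extChartAt 𝓘(ℝ, E) x).left_inv hy⟩
  rw [(extChartAt 𝓘(ℝ, E) x).right_inv hu, metricInChart_chartD hu]

variable [FiniteDimensional ℝ E]
  [IsContMDiffRiemannianBundle 𝓘(ℝ, E) ∞ E (fun x : M ↦ TangentSpace 𝓘(ℝ, E) x)]

/-- The transformation law of the Christoffel symbols under a change of charts. -/
theorem fderiv_transition_christoffel {x x' y : M} (hy : y ∈ (extChartAt 𝓘(ℝ, E) x).source)
    (hy' : y ∈ (extChartAt 𝓘(ℝ, E) x').source) (a b : E) :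
    fderiv ℝ (transition (E := E) x x') (extChartAt 𝓘(ℝ, E) x y)
        (christoffel (metricInChart x) (extChartAt 𝓘(ℝ, E) x y) a b) =
      fderiv ℝ (fderiv ℝ (transition (E := E) x x')) (extChartAt 𝓘(ℝ, E) x y) a b
        + christoffel (metricInChart x') (extChartAt 𝓘(ℝ, E) x' y)
          (fderiv ℝ (transition (E := E) x x') (extChartAt 𝓘(ℝ, E) x y) a)
          (fderiv ℝ (transition (E := E) x x') (extChartAt 𝓘(ℝ, E) x y) b) := by
  have hmet := (isMetricOn_metricInChart (E := E) x).mono (isOpen_transitionDomain x x')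
    Set.inter_subset_left
  have hmet' := isMetricOn_metricInChart (E := E) x'
  have hpull : ∀ u ∈ transitionDomain (E := E) x x', ∀ a b, metricInChart x u a b =
      metricInChart x' (transition x x' u) (fderiv ℝ (transition (E := E) x x') u a)
        (fderiv ℝ (transition (E := E) x x') u b) := by
    intro u hu a b
    have hz := (extChartAt 𝓘(ℝ, E) x).map_target hu.1
    obtain ⟨v, rfl⟩ := chartD_surjective hz a
    obtain ⟨w, rfl⟩ := chartD_surjective hz b
    have hr := (extChartAt 𝓘(ℝ, E) x).right_inv hu.1
    have h1 := fderiv_transition hz hu.2 v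
    have h2 := fderiv_transition hz hu.2 w
    rw [hr] at h1 h2
    rw [h1, h2, metricInChart_chartD hu.1]
    exact (metricInChart_extChartAt hu.2 v w).symm
  have htrans : transition (E := E) x x' (extChartAt 𝓘(ℝ, E) x y) = extChartAt 𝓘(ℝ, E) x' y := by
    rw [transition, Function.comp_apply, (extChartAt 𝓘(ℝ, E) x).left_inv hy]
  have hu : extChartAt 𝓘(ℝ, E) x y ∈ transitionDomain x x' :=
    ⟨(extChartAt 𝓘(ℝ, E) x).map_source hy, by
      rw [Set.mem_preimage, (extChartAt 𝓘(ℝ, E) x).left_inv hy]; exact hy'⟩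
  have hmaps : Set.MapsTo (transition (E := E) x x') (transitionDomain x x')
      (extChartAt 𝓘(ℝ, E) x').target := fun u hu ↦ (extChartAt 𝓘(ℝ, E) x').map_source hu.2
  -- The metric in one chart is the pullback of the other by the transition map; bijectivity of its
  -- derivative lets the pullback formula be tested against all vectors.
  have key := hmet'.apply_christoffel_pullback hmet (contDiffOn_transition x x') hmaps hpull hu a b
  refine hmet'.ext_left (hmaps hu) fun c ↦ ?_
  obtain ⟨c, rfl⟩ := (fderiv_transition_bijective hy hy').2 c
  rw [← hpull _ hu, key, htrans]

end ChartChange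

/-! ### Maps and fields along them read in charts -/

section Hypersurface

variable {E : Type*} [NormedAddCommGroup E] [NormedSpace ℝ E]
  {M : Type*} [TopologicalSpace M] [ChartedSpace E M]
  {F : Type*} [NormedAddCommGroup F] [NormedSpace ℝ F]
  {L : Type*} [TopologicalSpace L] [ChartedSpace F L]

/-- A map read in the preferred charts at `p` and at its image. -/
def mapInChart (ι : L → M) (p : L) (u : F) : E :=
  extChartAt 𝓘(ℝ, E) (ι p) (ι ((extChartAt 𝓘(ℝ, F) p).symm u))

/-- A vector field along a map, read in the preferred charts at `p` and at its image. -/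
def alongInChart (ι : L → M) (p : L) (V : ∀ q : L, TangentSpace 𝓘(ℝ, E) (ι q)) (u : F) : E :=
  chartD (ι p) (ι ((extChartAt 𝓘(ℝ, F) p).symm u)) (V ((extChartAt 𝓘(ℝ, F) p).symm u))

/-- The set of points near `p` where the preferred charts at `p` and at its image can be used. -/
def chartSet (E : Type*) [NormedAddCommGroup E] [NormedSpace ℝ E] {M : Type*} [TopologicalSpace M]
    [ChartedSpace E M] (F : Type*) [NormedAddCommGroup F] [NormedSpace ℝ F] {L : Type*}
    [TopologicalSpace L] [ChartedSpace F L] (ι : L → M) (p : L) : Set L :=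
  (extChartAt 𝓘(ℝ, F) p).source ∩ ι ⁻¹' (extChartAt 𝓘(ℝ, E) (ι p)).source

/-- The same set in the chart. -/
def chartDomain (E : Type*) [NormedAddCommGroup E] [NormedSpace ℝ E] {M : Type*}
    [TopologicalSpace M] [ChartedSpace E M] {F : Type*} [NormedAddCommGroup F] [NormedSpace ℝ F]
    {L : Type*} [TopologicalSpace L] [ChartedSpace F L] (ι : L → M) (p : L) : Set F :=
  (extChartAt 𝓘(ℝ, F) p).target ∩ (extChartAt 𝓘(ℝ, F) p).symm ⁻¹' chartSet E F ι p

variable {ι : L → M} {p q : L}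

theorem mem_chartSet_self : p ∈ chartSet E F ι p :=
  ⟨mem_extChartAt_source p, mem_extChartAt_source (ι p)⟩

theorem extChartAt_mem_chartDomain (hq : q ∈ chartSet E F ι p) :
    extChartAt 𝓘(ℝ, F) p q ∈ chartDomain E ι p :=
  ⟨(extChartAt 𝓘(ℝ, F) p).map_source hq.1, by
    rw [Set.mem_preimage, (extChartAt 𝓘(ℝ, F) p).left_inv hq.1]; exact hq⟩

theorem exists_of_mem_chartDomain {u : F} (hu : u ∈ chartDomain E ι p) :
    ∃ q ∈ chartSet E F ι p, extChartAt 𝓘(ℝ, F) p q = u :=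
  ⟨_, hu.2, (extChartAt 𝓘(ℝ, F) p).right_inv hu.1⟩

theorem mapInChart_extChartAt (hq : q ∈ chartSet E F ι p) :
    mapInChart ι p (extChartAt 𝓘(ℝ, F) p q) = extChartAt 𝓘(ℝ, E) (ι p) (ι q) := by
  rw [mapInChart, (extChartAt 𝓘(ℝ, F) p).left_inv hq.1]

theorem alongInChart_extChartAt (hq : q ∈ chartSet E F ι p)
    (V : ∀ q : L, TangentSpace 𝓘(ℝ, E) (ι q)) :
    alongInChart ι p V (extChartAt 𝓘(ℝ, F) p q) = chartD (ι p) (ι q) (V q) := by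
  rw [alongInChart, (extChartAt 𝓘(ℝ, F) p).left_inv hq.1]

theorem isOpen_chartSet (hι : Continuous ι) : IsOpen (chartSet E F ι p) :=
  (isOpen_extChartAt_source p).inter ((isOpen_extChartAt_source (ι p)).preimage hι)

theorem isOpen_chartDomain (hι : Continuous ι) : IsOpen (chartDomain E (F := F) ι p) :=
  (continuousOn_extChartAt_symm p).isOpen_inter_preimage (isOpen_extChartAt_target p)
    (isOpen_chartSet hι)

variable [IsManifold 𝓘(ℝ, E) ∞ M] [IsManifold 𝓘(ℝ, F) ∞ L]

theorem contDiffOn_mapInChart (hι : ContMDiff 𝓘(ℝ, F) 𝓘(ℝ, E) ∞ ι) :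
    ContDiffOn ℝ ∞ (mapInChart (E := E) ι p) (chartDomain E (F := F) ι p) := fun u hu ↦
  ((contMDiffAt_chart hu.2.2).comp (f := ι ∘ (extChartAt 𝓘(ℝ, F) p).symm) u ((hι _).comp u
    (contMDiffAt_chart_symm hu.1))).contDiffAt.contDiffWithinAt

theorem contDiffOn_alongInChart (hι : ContMDiff 𝓘(ℝ, F) 𝓘(ℝ, E) ∞ ι)
    {V : ∀ q : L, TangentSpace 𝓘(ℝ, E) (ι q)}
    (hV : ContMDiff 𝓘(ℝ, F) 𝓘(ℝ, E).tangent ∞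
      (fun q ↦ (⟨ι q, V q⟩ : TangentBundle 𝓘(ℝ, E) M))) :
    ContDiffOn ℝ ∞ (alongInChart ι p V) (chartDomain E (F := F) ι p) := by
  intro u hu
  have h := ((hV _).comp u (contMDiffAt_chart_symm hu.1))
  have h2 := (((trivializationAt E (TangentSpace 𝓘(ℝ, E) : M → Type _) (ι p)).contMDiffAt_iff
    (by simpa [Bundle.Trivialization.mem_source] using hu.2.2)).1 h).2
  refine (h2.congr_of_eventuallyEq ?_).contDiffAt.contDiffWithinAt
  filter_upwards [(isOpen_chartDomain hι.continuous).mem_nhds hu] with z hz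
  exact (trivializationAt_snd hz.2.2 _).symm

theorem fderiv_mapInChart (hι : ContMDiff 𝓘(ℝ, F) 𝓘(ℝ, E) ∞ ι) (hq : q ∈ chartSet E F ι p)
    (v : TangentSpace 𝓘(ℝ, F) q) :
    fderiv ℝ (mapInChart ι p) (extChartAt 𝓘(ℝ, F) p q) (chartD p q v) =
      chartD (ι p) (ι q) (mfderiv 𝓘(ℝ, F) 𝓘(ℝ, E) ι q v) := by
  have h1 := (contMDiffAt_chart hq.2).mdifferentiableAt (n := ∞) (by simp)
  have h2 := (hι q).mdifferentiableAt (by simp)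
  have h3 := mvfderiv_eq_fderiv_chart hq.1 (f := extChartAt 𝓘(ℝ, E) (ι p) ∘ ι) (h1.comp q h2) v
  have h4 : mvfderiv 𝓘(ℝ, F) (extChartAt 𝓘(ℝ, E) (ι p) ∘ ι) q v =
      chartD (ι p) (ι q) (mfderiv 𝓘(ℝ, F) 𝓘(ℝ, E) ι q v) :=
    DFunLike.congr_fun (mfderiv_comp q h1 h2) v
  exact (h4.symm.trans h3).symm

variable [RiemannianBundle (fun x : M ↦ TangentSpace 𝓘(ℝ, E) x)] [FiniteDimensional ℝ E]
  [IsContMDiffRiemannianBundle 𝓘(ℝ, E) ∞ E (fun x : M ↦ TangentSpace 𝓘(ℝ, E) x)]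

/-- The covariant derivative along a map, in the preferred charts at a nearby point. -/
theorem chartD_covDerivAlong [FiniteDimensional ℝ F]
    (hι : ContMDiff 𝓘(ℝ, F) 𝓘(ℝ, E) ∞ ι) (hq : q ∈ chartSet E F ι p)
    {V : ∀ q : L, TangentSpace 𝓘(ℝ, E) (ι q)}
    (hV : DifferentiableAt ℝ (alongInChart ι p V) (extChartAt 𝓘(ℝ, F) p q))
    (v : TangentSpace 𝓘(ℝ, F) q) :
    chartD (ι p) (ι q) (covDerivAlong ι V q v) =
      covAlong (metricInChart (ι p)) (mapInChart ι p) (alongInChart ι p V)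
        (extChartAt 𝓘(ℝ, F) p q) (chartD p q v) := by
  set u := extChartAt 𝓘(ℝ, F) p q with hu
  set χ := transition (E := E) (ι p) (ι q) with hχ
  have hqq := mem_extChartAt_source (I := 𝓘(ℝ, E)) (ι q)
  have hφu : mapInChart ι p u = extChartAt 𝓘(ℝ, E) (ι p) (ι q) := mapInChart_extChartAt hq
  have hdom := (isOpen_chartDomain (p := p) hι.continuous).mem_nhds (extChartAt_mem_chartDomain hq)
  let Vc : L → E := fun q' ↦
    (trivializationAt E (TangentSpace 𝓘(ℝ, E) : M → Type _) (ι q) ⟨ι q', V q'⟩).2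
  have hcov : covDerivAlong ι V q v = (mvfderiv 𝓘(ℝ, F) Vc q v : E) +
      christoffel (metricInChart (ι q)) (extChartAt 𝓘(ℝ, E) (ι q) (ι q))
        (mfderiv 𝓘(ℝ, F) 𝓘(ℝ, E) ι q v : E) (V q : E) := rfl
  -- `covDerivAlong` at `q` uses the chart at `ι q`; there the components of `V` are those in the
  -- chart at `ι p` transformed by `Dχ`. Differentiating produces an extra term in `D²χ`.
  have hVc : Vc ∘ (extChartAt 𝓘(ℝ, F) p).symm =ᶠ[nhds u]
      fun z ↦ fderiv ℝ χ (mapInChart ι p z) (alongInChart ι p V z) := by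
    have hopen : (ι ∘ (extChartAt 𝓘(ℝ, F) p).symm) ⁻¹' (extChartAt 𝓘(ℝ, E) (ι q)).source ∈
        nhds u := by
      refine (hι.continuous.continuousAt.comp
        ((contMDiffAt_chart_symm ((extChartAt 𝓘(ℝ, F) p).map_source hq.1)).continuousAt)
        ).preimage_mem_nhds ?_
      refine (isOpen_extChartAt_source (ι q)).mem_nhds ?_
      simp only [Function.comp_apply, (extChartAt 𝓘(ℝ, F) p).left_inv hq.1, hqq]
    filter_upwards [hdom, hopen] with z hz hz'
    rw [Function.comp_apply, alongInChart, mapInChart, hχ, fderiv_transition hz.2.2 hz']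
    exact trivializationAt_snd hz' _
  have hχs := contDiffOn_transition (E := E) (ι p) (ι q)
  have hmem : mapInChart ι p u ∈ transitionDomain (E := E) (ι p) (ι q) := by
    rw [hφu]
    exact ⟨(extChartAt 𝓘(ℝ, E) (ι p)).map_source hq.2, by
      rw [Set.mem_preimage, (extChartAt 𝓘(ℝ, E) (ι p)).left_inv hq.2]; exact hqq⟩
  have hφd := ((contDiffOn_mapInChart (p := p) hι).contDiffAt hdom).differentiableAt
    (by simp) |>.hasFDerivAt
  have hder := (((hasFDerivAt_fderiv_of_contDiffOn (isOpen_transitionDomain _ _) hχs hmem).comp u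
    hφd).clm_apply hV.hasFDerivAt).congr_of_eventuallyEq hVc
  have h1 := mvfderiv_eq_fderiv_chart hq.1
    (mdifferentiableAt_of_comp_chart_symm hq.1 hder.differentiableAt) v
  rw [hder.fderiv] at h1
  have h2 : (mfderiv 𝓘(ℝ, F) 𝓘(ℝ, E) ι q v : E) = fderiv ℝ χ (mapInChart ι p u)
      (fderiv ℝ (mapInChart ι p) u (chartD p q v)) := by
    rw [fderiv_mapInChart hι hq, hφu, fderiv_transition hq.2 hqq]
    exact (chartD_self (E := E) (ι q) _).symm
  have h3 : (V q : E) = fderiv ℝ χ (mapInChart ι p u) (alongInChart ι p V u) := by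
    rw [alongInChart_extChartAt hq, hφu, fderiv_transition hq.2 hqq]
    exact (chartD_self (E := E) (ι q) _).symm
  have hbij := fderiv_transition_bijective hq.2 hqq
  rw [← hφu] at hbij
  refine hbij.1 ?_
  have h4 : fderiv ℝ (transition (E := E) (ι p) (ι q)) (mapInChart ι p u)
      (chartD (ι p) (ι q) (covDerivAlong ι V q v)) = (covDerivAlong ι V q v : E) := by
    rw [hφu, fderiv_transition hq.2 hqq]
    exact chartD_self (E := E) (ι q) _
  rw [h4, hcov, h1, h2, h3, covAlong_apply, map_add]
  -- The inhomogeneous term of the transformation law is exactly that `D²χ` term.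
  have h5 := fderiv_transition_christoffel hq.2 hqq
    (fderiv ℝ (mapInChart ι p) u (chartD p q v)) (alongInChart ι p V u)
  rw [← hφu] at h5
  rw [h5]
  exact add_assoc _ _ _

end Hypersurface

/-! ### Transfer from coordinates to the hypersurface -/

section RiemannianHypersurface

variable {E : Type*} [NormedAddCommGroup E] [NormedSpace ℝ E]
  {M : Type*} [TopologicalSpace M] [ChartedSpace E M]
  [RiemannianBundle (fun x : M ↦ TangentSpace 𝓘(ℝ, E) x)]
  {F : Type*} [NormedAddCommGroup F] [NormedSpace ℝ F]
  {L : Type*} [TopologicalSpace L] [ChartedSpace F L]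
  [RiemannianBundle (fun p : L ↦ TangentSpace 𝓘(ℝ, F) p)]
  {ι : L → M} {N : ∀ p : L, TangentSpace 𝓘(ℝ, E) (ι p)} {p q : L}

/-- A vector killed by `dι` has zero length in the induced metric, so preservation of inner products
already makes `ι` an immersion. -/
theorem IsIsometricImmersion.mfderiv_injective
    (hι : IsIsometricImmersion (E := E) (F := F) ι) (q : L) :
    Function.Injective (mfderiv 𝓘(ℝ, F) 𝓘(ℝ, E) ι q) := by
  rw [injective_iff_map_eq_zero]
  intro v hv
  have h := hι.inner_mfderiv q v v
  rw [hv, inner_zero_left] at h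
  exact inner_self_eq_zero.1 h.symm

theorem newton_eq_newtonTransform [FiniteDimensional ℝ E] [IsManifold 𝓘(ℝ, E) ∞ M]
    [FiniteDimensional ℝ F] (r : ℕ) :
    newton (F := F) ι N r p = newtonTransform (shapeOperator (F := F) ι N p) r := by
  induction r with
  | zero => rfl
  | succ r ih => rw [newton, newtonTransform, ih]; rfl

variable [FiniteDimensional ℝ E] [IsManifold 𝓘(ℝ, E) ∞ M] [IsManifold 𝓘(ℝ, F) ∞ L]
  [IsContMDiffRiemannianBundle 𝓘(ℝ, E) ∞ E (fun x : M ↦ TangentSpace 𝓘(ℝ, E) x)]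

/-- A hypersurface read in preferred charts. -/
theorem IsIsometricImmersion.isHypersurfaceOn
    (hι : IsIsometricImmersion (E := E) (F := F) ι) (hN : IsUnitNormal (F := F) ι N)
    (hcodim : Module.finrank ℝ E = Module.finrank ℝ F + 1) (p : L) :
    IsHypersurfaceOn (metricInChart (E := E) (ι p)) (extChartAt 𝓘(ℝ, E) (ι p)).target
      (mapInChart (E := E) ι p) (alongInChart ι p N) (chartDomain E (F := F) ι p) where
  metric := isMetricOn_metricInChart (ι p)
  isOpen := isOpen_chartDomain hι.contMDiff.continuous
  contDiffOn := contDiffOn_mapInChart hι.contMDiff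
  mapsTo u hu := (extChartAt 𝓘(ℝ, E) (ι p)).map_source hu.2.2
  injective u hu := by
    obtain ⟨q, hq, rfl⟩ := exists_of_mem_chartDomain hu
    intro a b hab
    obtain ⟨v, rfl⟩ := chartD_surjective hq.1 a
    obtain ⟨w, rfl⟩ := chartD_surjective hq.1 b
    rw [fderiv_mapInChart hι.contMDiff hq, fderiv_mapInChart hι.contMDiff hq] at hab
    rw [hι.mfderiv_injective q (chartD_injective hq.2 hab)]
  contDiffOn_normal := contDiffOn_alongInChart hι.contMDiff hN.contMDiff
  normal_unit u hu := by
    obtain ⟨q, hq, rfl⟩ := exists_of_mem_chartDomain hu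
    rw [mapInChart_extChartAt hq, alongInChart_extChartAt hq, metricInChart_extChartAt hq.2,
      real_inner_self_eq_norm_sq, hN.norm_eq_one, one_pow]
  normal_orthogonal u hu a := by
    obtain ⟨q, hq, rfl⟩ := exists_of_mem_chartDomain hu
    obtain ⟨v, rfl⟩ := chartD_surjective hq.1 a
    rw [mapInChart_extChartAt hq, alongInChart_extChartAt hq, fderiv_mapInChart hι.contMDiff hq,
      metricInChart_extChartAt hq.2, hN.inner_eq_zero]
  codim := hcodim

section

variable [FiniteDimensional ℝ F]
  (hι : IsIsometricImmersion (E := E) (F := F) ι) (hN : IsUnitNormal (F := F) ι N)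
  (hcodim : Module.finrank ℝ E = Module.finrank ℝ F + 1)
include hι hN hcodim

/-- The adjoint of `dι` and the coordinate projection have the same inner products with all tangent
vectors. -/
theorem chartD_tangentialPart (hq : q ∈ chartSet E F ι p) (w : TangentSpace 𝓘(ℝ, E) (ι q)) :
    chartD p q (tangentialPart (E := E) (F := F) ι q w) =
      tangentialProj (metricInChart (ι p)) (mapInChart ι p) (extChartAt 𝓘(ℝ, F) p q)
        (chartD (ι p) (ι q) w) := by
  have h := hι.isHypersurfaceOn hN hcodim p
  have hu := extChartAt_mem_chartDomain hq
  refine h.ext_tangent hu fun c ↦ ?_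
  obtain ⟨c, rfl⟩ := chartD_surjective hq.1 c
  rw [h.apply_tangentialProj hu, fderiv_mapInChart hι.contMDiff hq,
    fderiv_mapInChart hι.contMDiff hq, mapInChart_extChartAt hq, metricInChart_extChartAt hq.2,
    metricInChart_extChartAt hq.2, hι.inner_mfderiv]
  exact ContinuousLinearMap.adjoint_inner_left _ _ _

theorem chartD_shapeOperator (hq : q ∈ chartSet E F ι p) (v : TangentSpace 𝓘(ℝ, F) q) :
    chartD p q (shapeOperator (F := F) ι N q v) =
      localShape (metricInChart (ι p)) (mapInChart ι p) (alongInChart ι p N)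
        (extChartAt 𝓘(ℝ, F) p q) (chartD p q v) := by
  have h := hι.isHypersurfaceOn hN hcodim p
  have hu := extChartAt_mem_chartDomain hq
  have h1 := chartD_tangentialPart hι hN hcodim hq (covDerivAlong ι N q v)
  rw [chartD_covDerivAlong hι.contMDiff hq (hasFDerivAt_of_contDiffOn h.isOpen
    h.contDiffOn_normal hu).differentiableAt] at h1
  exact (map_neg (chartD p q) _).trans (congrArg Neg.neg h1)

/-- Supplies the splitting of the characteristic polynomial over the reals. -/
theorem shapeOperator_isSymmetric (q : L) : (shapeOperator (F := F) ι N q).IsSymmetric := by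
  intro v w
  have hq := mem_chartSet_self (E := E) (F := F) (ι := ι) (p := q)
  have key := (hι.isHypersurfaceOn hN hcodim q).localShape_symm (extChartAt_mem_chartDomain hq)
    (chartD q q v) (chartD q q w)
  rw [← chartD_shapeOperator hι hN hcodim hq, ← chartD_shapeOperator hι hN hcodim hq,
    fderiv_mapInChart hι.contMDiff hq, fderiv_mapInChart hι.contMDiff hq,
    fderiv_mapInChart hι.contMDiff hq, fderiv_mapInChart hι.contMDiff hq, mapInChart_extChartAt hq,
    metricInChart_extChartAt hq.2, metricInChart_extChartAt hq.2, hι.inner_mfderiv,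
    hι.inner_mfderiv] at key
  exact key

/-- The two operators are conjugate by the derivative of the chart, so `S_{r+1}` at all points near
`p` can be read in one fixed chart and differentiated. -/
theorem charpoly_localShape (hq : q ∈ chartSet E F ι p) :
    (localShape (metricInChart (ι p)) (mapInChart ι p) (alongInChart ι p N)
        (extChartAt 𝓘(ℝ, F) p q) : F →ₗ[ℝ] F).charpoly =
      (shapeOperator (F := F) ι N q).charpoly := by
  let σ : TangentSpace 𝓘(ℝ, F) q ≃ₗ[ℝ] F := LinearEquiv.ofBijective (chartD p q).toLinearMap
    ⟨chartD_injective hq.1, chartD_surjective hq.1⟩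
  rw [← σ.charpoly_conj]
  congr 1
  ext a
  obtain ⟨v, rfl⟩ := σ.surjective a
  rw [LinearEquiv.conj_apply_apply, LinearEquiv.symm_apply_apply]
  exact (chartD_shapeOperator hι hN hcodim hq v).symm

theorem chartD_grad {f : L → ℝ} (hq : q ∈ chartSet E F ι p)
    (hf : MDifferentiableAt 𝓘(ℝ, F) 𝓘(ℝ, ℝ) f q) :
    chartD p q (grad f q) = localGrad (metricInChart (E := E) (ι p)) (mapInChart ι p)
      (f ∘ (extChartAt 𝓘(ℝ, F) p).symm) (extChartAt 𝓘(ℝ, F) p q) := by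
  have h := hι.isHypersurfaceOn hN hcodim p
  have hu := extChartAt_mem_chartDomain hq
  refine h.ext_tangent hu fun c ↦ ?_
  obtain ⟨c, rfl⟩ := chartD_surjective hq.1 c
  rw [h.apply_localGrad hu, fderiv_mapInChart hι.contMDiff hq,
    fderiv_mapInChart hι.contMDiff hq, mapInChart_extChartAt hq, metricInChart_extChartAt hq.2,
    hι.inner_mfderiv, ← mvfderiv_eq_fderiv_chart hq.1 hf, grad]
  exact InnerProductSpace.toDual_symm_apply

theorem chartD_hess {f : L → ℝ} (hf : ContMDiff 𝓘(ℝ, F) 𝓘(ℝ, ℝ) ∞ f)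
    (hq : q ∈ chartSet E F ι p) (v : TangentSpace 𝓘(ℝ, F) q) :
    chartD p q (hess (E := E) ι f q v) =
      tangentialProj (metricInChart (E := E) (ι p)) (mapInChart ι p) (extChartAt 𝓘(ℝ, F) p q)
        (covAlong (metricInChart (ι p)) (mapInChart ι p) (fun z ↦ fderiv ℝ (mapInChart ι p) z
          (localGrad (metricInChart (E := E) (ι p)) (mapInChart ι p)
            (f ∘ (extChartAt 𝓘(ℝ, F) p).symm) z)) (extChartAt 𝓘(ℝ, F) p q) (chartD p q v)) := by
  have h := hι.isHypersurfaceOn hN hcodim p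
  have hu := extChartAt_mem_chartDomain hq
  have hnhds := h.isOpen.mem_nhds hu
  have heq : ∀ z ∈ chartDomain E (F := F) ι p,
      alongInChart ι p (fun q ↦ mfderiv 𝓘(ℝ, F) 𝓘(ℝ, E) ι q (grad f q)) z =
        fderiv ℝ (mapInChart (E := E) ι p) z (localGrad (metricInChart (E := E) (ι p))
          (mapInChart ι p) (f ∘ (extChartAt 𝓘(ℝ, F) p).symm) z) := by
    intro z hz
    obtain ⟨q, hq, rfl⟩ := exists_of_mem_chartDomain hz
    rw [alongInChart_extChartAt hq, ← fderiv_mapInChart hι.contMDiff hq,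
      chartD_grad hι hN hcodim hq (hf.mdifferentiable (by simp) q)]
  have hfs : ContDiffOn ℝ ∞ (f ∘ (extChartAt 𝓘(ℝ, F) p).symm) (chartDomain E ι p) := fun z hz ↦
    ((hf _).comp z (contMDiffAt_chart_symm hz.1)).contDiffAt.contDiffWithinAt
  have hd := ((hasFDerivAt_of_contDiffOn h.isOpen (ContDiffOn.congr
    (h.contDiffOn_fderiv.clm_apply (h.contDiffOn_localGrad hfs)) heq)) hu).differentiableAt
  have h1 := chartD_tangentialPart hι hN hcodim hq
    (covDerivAlong ι (fun q ↦ mfderiv 𝓘(ℝ, F) 𝓘(ℝ, E) ι q (grad f q)) q v)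
  rw [chartD_covDerivAlong hι.contMDiff hq hd, covAlong_congr hnhds heq] at h1
  exact h1

theorem normalPart_eq (U : ∀ x : M, TangentSpace 𝓘(ℝ, E) x) (q : L) :
    normalPart (F := F) ι U q = (inner ℝ (U (ι q)) (N q) : ℝ) • N q := by
  have hq := mem_chartSet_self (E := E) (F := F) (ι := ι) (p := q)
  obtain ⟨a, t, h⟩ := (hι.isHypersurfaceOn hN hcodim q).exists_decomposition
    (extChartAt_mem_chartDomain hq) (chartD (ι q) (ι q) (U (ι q)))
  obtain ⟨v, rfl⟩ := chartD_surjective hq.1 a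
  rw [fderiv_mapInChart hι.contMDiff hq, alongInChart_extChartAt hq, ← map_smul, ← map_add] at h
  have hU := chartD_injective hq.2 h
  have hNmem : N q ∈ (mfderiv 𝓘(ℝ, F) 𝓘(ℝ, E) ι q).rangeᗮ := by
    rw [Submodule.mem_orthogonal]
    rintro _ ⟨w, rfl⟩
    exact hN.inner_eq_zero q w
  have ht : (inner ℝ (U (ι q)) (N q) : ℝ) = t := by
    rw [hU, inner_add_left, hN.inner_eq_zero, zero_add, real_inner_smul_left,
      real_inner_self_eq_norm_sq, hN.norm_eq_one, one_pow, mul_one]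
  have hv : mfderiv 𝓘(ℝ, F) 𝓘(ℝ, E) ι q v ∈ (mfderiv 𝓘(ℝ, F) 𝓘(ℝ, E) ι q).range := ⟨v, rfl⟩
  rw [ht, normalPart, hU, map_add, map_smul, Submodule.starProjection_eq_self_iff.2 hNmem,
    Submodule.starProjection_orthogonal_apply_eq_zero hv, zero_add]

theorem inner_normalPart (U : ∀ x : M, TangentSpace 𝓘(ℝ, E) x) (q : L) :
    (inner ℝ (normalPart (F := F) ι U q) (N q) : ℝ) = inner ℝ (U (ι q)) (N q) := by
  rw [normalPart_eq hι hN hcodim, real_inner_smul_left, real_inner_self_eq_norm_sq,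
    hN.norm_eq_one, one_pow, mul_one]

/-- The support function of a Killing field is in the kernel of `J_r`. -/
theorem opJ_support_function {U : ∀ x : M, TangentSpace 𝓘(ℝ, E) x} (hU : IsKillingField U)
    {r : ℕ} {c : ℝ} (hS : ∀ p, meanCurv (F := F) ι N (r + 1) p = c) {f : L → ℝ}
    (hf : ContMDiff 𝓘(ℝ, F) 𝓘(ℝ, ℝ) ∞ f) (hfU : ∀ q, f q = inner ℝ (U (ι q)) (N q)) (p : L) :
    opJ (F := F) ι N r f p = 0 := by
  have h := hι.isHypersurfaceOn hN hcodim p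
  have hp := mem_chartSet_self (E := E) (F := F) (ι := ι) (p := p)
  have hA (v : F) : shapeOperator (F := F) ι N p v =
      localShape (metricInChart (ι p)) (mapInChart ι p) (alongInChart ι p N)
        (extChartAt 𝓘(ℝ, F) p p) v := by
    have h1 := chartD_shapeOperator hι hN hcodim hp v
    exact ((chartD_self (E := F) p _).symm.trans h1).trans
      (congrArg (fun w : F ↦ localShape _ _ _ _ w) (chartD_self (E := F) p v))
  -- Splitting and constancy are checked throughout the chart domain, whereas the operators `A`,
  -- `H`, `R` are compared only at `p`, where the chart derivative is the identity.
  have key := h.jacobi_equation (U := fieldInChart (ι p) U) (contDiffOn_fieldInChart hU.contMDiff)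
    (fun y hy ↦ hU.chart_equation (ι p) hy) (r := r) (c := c) (fun z hz ↦ by
      obtain ⟨q, hq, rfl⟩ := exists_of_mem_chartDomain hz
      rw [charpoly_localShape hι hN hcodim hq]
      exact (shapeOperator_isSymmetric hι hN hcodim q).splits_charpoly)
    (fun z hz ↦ by
      obtain ⟨q, hq, rfl⟩ := exists_of_mem_chartDomain hz
      rw [esymmEigenvalues, charpoly_localShape hι hN hcodim hq]
      exact hS q)
    (extChartAt_mem_chartDomain hp) (f := f ∘ (extChartAt 𝓘(ℝ, F) p).symm)
    (fun z hz ↦ by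
      obtain ⟨q, hq, rfl⟩ := exists_of_mem_chartDomain hz
      rw [mapInChart_extChartAt hq, alongInChart_extChartAt hq, fieldInChart,
        (extChartAt 𝓘(ℝ, E) (ι p)).left_inv hq.2, metricInChart_extChartAt hq.2,
        Function.comp_apply, (extChartAt 𝓘(ℝ, F) p).left_inv hq.1, hfU])
    (A := shapeOperator (F := F) ι N p) (H := hess (E := E) ι f p)
    (R := normalCurvature (F := F) ι N p) (LinearMap.ext hA)
    (fun a ↦ by
      have h1 := chartD_hess hι hN hcodim hf hp a
      exact ((chartD_self (E := F) p _).symm.trans h1).trans (congrArg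
        (fun w : F ↦ tangentialProj _ _ _ (covAlong _ _ _ _ w)) (chartD_self (E := F) p a)))
    (fun a ↦ by
      have h1 := chartD_tangentialPart hι hN hcodim hp (jacobiCurvature (E := E)
        (metricInChart (ι p)) (extChartAt 𝓘(ℝ, E) (ι p) (ι p)) (N p)
        (mfderiv 𝓘(ℝ, F) 𝓘(ℝ, E) ι p a))
      have h2 : fderiv ℝ (mapInChart (E := E) ι p) (extChartAt 𝓘(ℝ, F) p p) a =
          (mfderiv 𝓘(ℝ, F) 𝓘(ℝ, E) ι p a : E) :=
        ((congrArg (fun w : F ↦ fderiv ℝ (mapInChart (E := E) ι p) _ w)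
          (chartD_self (E := F) p a)).symm.trans
          (fderiv_mapInChart hι.contMDiff hp a)).trans (chartD_self (E := E) (ι p) _)
      have h3 : alongInChart ι p N (extChartAt 𝓘(ℝ, F) p p) = (N p : E) :=
        (alongInChart_extChartAt hp N).trans (chartD_self (E := E) (ι p) _)
      refine ((chartD_self (E := F) p _).symm.trans h1).trans (congrArg
        (fun w : E ↦ tangentialProj _ _ _ w) ((chartD_self (E := E) (ι p) _).trans ?_))
      rw [h2, h3, mapInChart_extChartAt hp]
      rfl)
  rw [Function.comp_apply, (extChartAt 𝓘(ℝ, F) p).left_inv hp.1] at key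
  rw [opJ, opL, newton_eq_newtonTransform]
  exact key

theorem isJacobiField_normalPart {U : ∀ x : M, TangentSpace 𝓘(ℝ, E) x} (hU : IsKillingField U)
    {r : ℕ} {c : ℝ} (hS : ∀ p, meanCurv (F := F) ι N (r + 1) p = c) :
    IsJacobiField (F := F) ι N r (normalPart (F := F) ι U) := by
  have hf : ContMDiff 𝓘(ℝ, F) 𝓘(ℝ, ℝ) ∞ (fun q ↦ (inner ℝ (U (ι q)) (N q) : ℝ)) :=
    ContMDiff.inner_bundle (F := E) (E := fun x : M ↦ TangentSpace 𝓘(ℝ, E) x) (b := ι)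
      (v := fun q ↦ U (ι q)) (w := N) (hU.contMDiff.comp hι.contMDiff) hN.contMDiff
  refine ⟨fun p ↦ ?_, fun p v ↦ ?_, fun p ↦ ?_⟩
  · have hp := mem_chartSet_self (E := E) (F := F) (ι := ι) (p := p)
    have hsrc (V : ∀ p : L, TangentSpace 𝓘(ℝ, E) (ι p)) :
        (⟨ι p, V p⟩ : TangentBundle 𝓘(ℝ, E) M) ∈
          (trivializationAt E (TangentSpace 𝓘(ℝ, E) : M → Type _) (ι p)).source :=
      (Bundle.Trivialization.mem_source _).2 (by simp)
    -- Smoothness of `U^⊥ = f N` is read in the trivialization, where it is a smooth function times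
    -- the components of `N`.
    have h1 := (((trivializationAt E (TangentSpace 𝓘(ℝ, E) : M → Type _) (ι p)).contMDiffAt_iff
      (f := fun p ↦ (⟨ι p, N p⟩ : TangentBundle 𝓘(ℝ, E) M)) (hsrc N)).1 (hN.contMDiff p)).2
    refine ((trivializationAt E (TangentSpace 𝓘(ℝ, E) : M → Type _) (ι p)).contMDiffAt_iff
      (f := fun p ↦ (⟨ι p, normalPart (F := F) ι U p⟩ : TangentBundle 𝓘(ℝ, E) M)) (hsrc _)).2
      ⟨hι.contMDiff p, ((hf p).smul h1).congr_of_eventuallyEq ?_⟩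
    filter_upwards [(isOpen_chartSet hι.contMDiff.continuous).mem_nhds hp] with q hq
    rw [normalPart_eq hι hN hcodim, trivializationAt_snd hq.2, map_smul]
    exact congrArg _ (trivializationAt_snd hq.2 _).symm
  · rw [normalPart_eq hι hN hcodim, real_inner_smul_right, hN.inner_eq_zero, mul_zero]
  · have hJ := opJ_support_function hι hN hcodim hU hS hf (fun _ ↦ rfl) p
    rw [opJNormal, funext (inner_normalPart hι hN hcodim U), hJ, zero_smul]

end

end RiemannianHypersurface

end HypersurfaceJacobi

end

theorem propositionp
    {E : Type*} [NormedAddCommGroup E] [NormedSpace ℝ E] [FiniteDimensional ℝ E]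
    {M : Type*} [TopologicalSpace M] [ChartedSpace E M] [IsManifold 𝓘(ℝ, E) ∞ M]
    [Bundle.RiemannianBundle (fun x : M ↦ TangentSpace 𝓘(ℝ, E) x)]
    [IsContMDiffRiemannianBundle 𝓘(ℝ, E) ∞ E (fun x : M ↦ TangentSpace 𝓘(ℝ, E) x)]
    {F : Type*} [NormedAddCommGroup F] [NormedSpace ℝ F] [FiniteDimensional ℝ F]
    {L : Type*} [TopologicalSpace L] [ChartedSpace F L] [IsManifold 𝓘(ℝ, F) ∞ L]
    [Bundle.RiemannianBundle (fun p : L ↦ TangentSpace 𝓘(ℝ, F) p)]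
    [IsContMDiffRiemannianBundle 𝓘(ℝ, F) ∞ F (fun p : L ↦ TangentSpace 𝓘(ℝ, F) p)]
    (hcodim : Module.finrank ℝ E = Module.finrank ℝ F + 1)
    (ι : L → M) (hι : HypersurfaceJacobi.IsIsometricImmersion (E := E) (F := F) ι)
    (N : ∀ p : L, TangentSpace 𝓘(ℝ, E) (ι p))
    (hN : HypersurfaceJacobi.IsUnitNormal (F := F) ι N)
    (r : ℕ)
    (hS : ∃ c : ℝ, ∀ p : L, HypersurfaceJacobi.meanCurv (F := F) ι N (r + 1) p = c)
    (U : ∀ x : M, TangentSpace 𝓘(ℝ, E) x) (hU : HypersurfaceJacobi.IsKillingField U) :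
    HypersurfaceJacobi.IsJacobiField (F := F) ι N r
      (HypersurfaceJacobi.normalPart (F := F) ι U) := by
  obtain ⟨c, hc⟩ := hS
  exact HypersurfaceJacobi.isJacobiField_normalPart hι hN hcodim hU hc
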